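/- Let $(\Omega,\mathcal F,P)$ be a nonatomic probability space. Let $L^\infty_{++}$ be the set of (classes of $P$-a.s. equal) random variables $X\in L^\infty(\Omega,\mathcal F,P)$ such that $X\ge c$ $P$-a.s. for some constant $c>0$; equalities and inequalities between random variables hold $P$-a.s. Let $\rho\colon L^\infty_{++}\to(0,+\infty)$ be a geometrically convex return risk measure, that is, - (monotonicity) $X\le Y$ implies $\rho(X)\le\rho(Y)$; - (positive homogeneity) $\rho(\lambda X)=\lambda\rho(X)$ for every constant $\lambda>0$; - (normalization) $\rho(1)=1$; - (geometric convexity) $\rho(X^\lambda Y^{1-\lambda})\le\rho(X)^\lambda\rho(Y)^{1-\lambda}$ for all $X,Y\in L^\infty_{++}$ and $\lambda\in(0,1)$. Assume that $\rho$ has the lower-bounded Fatou property: if $X_n\to X$ in $P$-probability, $\|X_n\|_\infty\le k$ and $X_n\ge c>0$ for all $n$, with constants $k,c$, then $\rho(X)\le\liminf_n\rho(X_n)$. Let $\mathbf P$ be the set of probability measures $Q$ on $(\Omega,\mathcal F)$ with $Q\ll P$, let $\varphi_Q=dQ/dP$, let $B_\rho=\{X\in L^\infty_{++}:\rho(X)\le1\}$,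 and put $$\alpha(Q)=\Big[\sup_{X\in B_\rho}\exp\big(\mathbb E_Q[\log X]\big)\Big]^{-1},\qquad Q\in\mathbf P,\qquad \text{with } 1/(+\infty)=0.$$ Then: 1. $\alpha(Q)\in[0,1]$ for every $Q\in\mathbf P$, and for every $X\in L^\infty_{++}$ $$\rho(X)=\sup_{Q\in\mathbf P}\big\{\alpha(Q)\exp\big(\mathbb E_Q[\log X]\big)\big\}.$$ 2. If moreover $\rho$ has the lower-bounded Lebesgue property (under the same conditions on $X_n,X$ as above, $\rho(X_n)\to\rho(X)$), then for every $X\in L^\infty_{++}$ the supremum in 1 is attained by some $Q\in\mathbf P$. 3. If moreover $\rho$ is law-invariant ($\rho(X)=\rho(Y)$ whenever $X$ and $Y$ have the same distribution under $P$), let $q_Z$ denote any version of the quantile function under $P$ of a real random variable $Z$, that is, any function $q_Z\colon(0,1)\to\mathbb R$ with $P(Z<q_Z(t))\le t\le P(Z\le q_Z(t))$ for all $t\in(0,1)$. Then, for every $Q\in\mathbf P$, $$\alpha(Q)=\Big[\sup_{X\in B_\rho}\exp\Big(\int_0^1 q_{\log X}(t)\,q_{\varphi_Q}(t)\,dt\Big)\Big]^{-1},$$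 and, for every $X\in L^\infty_{++}$, $$\rho(X)=\sup_{Q\in\mathbf P}\Big\{\alpha(Q)\exp\Big(\int_0^1 q_{\log X}(t)\,q_{\varphi_Q}(t)\,dt\Big)\Big\}.$$ -/

import Mathlib

open MeasureTheory ProbabilityTheory Filter Topology
open scoped ENNReal

namespace ReturnRisk

variable {Ω : Type*} [MeasurableSpace Ω]

/-- A measure is nonatomic if every measurable set of positive measure has a measurable subset of
positive, strictly smaller measure. -/
def IsNonatomic (P : Measure Ω) : Prop :=
  ∀ A : Set Ω, MeasurableSet A → 0 < P A → ∃ B ⊆ A, MeasurableSet B ∧ 0 < P B ∧ P B < P A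

/-- `L^∞_{++}`: the elements of `L^∞(P)` that are a.s. bounded below by a constant `c > 0`. -/
def LInfPP (P : Measure Ω) : Type _ :=
  {X : Lp ℝ ∞ P // ∃ c : ℝ, 0 < c ∧ ∀ᵐ ω ∂P, c ≤ X ω}

namespace LInfPP

variable {P : Measure Ω}

noncomputable instance : CoeFun (LInfPP P) (fun _ => Ω → ℝ) := ⟨fun X => (X.1 : Ω → ℝ)⟩

theorem aestronglyMeasurable (X : LInfPP P) : AEStronglyMeasurable X P :=
  Lp.aestronglyMeasurable X.1

theorem exists_bounds (X : LInfPP P) :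
    ∃ c C : ℝ, 0 < c ∧ 0 < C ∧ ∀ᵐ ω ∂P, c ≤ X ω ∧ X ω ≤ C := by
  obtain ⟨c, hc, h⟩ := X.2
  have hX : MemLp X ∞ P := Lp.memLp X.1
  have h2 := ae_le_lpNorm_exponent_top hX
  refine ⟨c, max 1 (lpNorm X ∞ P), hc, lt_max_of_lt_left one_pos, ?_⟩
  filter_upwards [h, h2] with ω h1 h2
  exact ⟨h1, ((le_abs_self _).trans h2).trans (le_max_right _ _)⟩

theorem memLp_of_bounds {f : Ω → ℝ} (hf : AEStronglyMeasurable f P)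
    (hb : ∃ c C : ℝ, 0 < c ∧ ∀ᵐ ω ∂P, c ≤ f ω ∧ f ω ≤ C) : MemLp f ∞ P := by
  obtain ⟨c, C, hc, h⟩ := hb
  refine memLp_top_of_bound hf C ?_
  filter_upwards [h] with ω hω
  rw [Real.norm_eq_abs, abs_of_pos (hc.trans_le hω.1)]
  exact hω.2

/-- The class in `L^∞_{++}` of a random variable with values a.s. in `[c, C]`, `c > 0`. -/
noncomputable def ofFun (f : Ω → ℝ) (hf : AEStronglyMeasurable f P)
    (hb : ∃ c C : ℝ, 0 < c ∧ ∀ᵐ ω ∂P, c ≤ f ω ∧ f ω ≤ C) : LInfPP P :=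
  ⟨MemLp.toLp f (memLp_of_bounds hf hb), by
      have hb' := hb
      obtain ⟨c, C, hc, h⟩ := hb'
      refine ⟨c, hc, ?_⟩
      filter_upwards [h, (memLp_of_bounds hf hb).coeFn_toLp] with ω h1 h2
      rw [h2]
      exact h1.1⟩

theorem coeFn_ofFun (f : Ω → ℝ) (hf : AEStronglyMeasurable f P)
    (hb : ∃ c C : ℝ, 0 < c ∧ ∀ᵐ ω ∂P, c ≤ f ω ∧ f ω ≤ C) : ofFun f hf hb =ᵐ[P] f :=
  (memLp_of_bounds hf hb).coeFn_toLp

/-- The constant random variable `1`. -/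
noncomputable def one : LInfPP P :=
  ofFun (fun _ => 1) aestronglyMeasurable_const
    ⟨1, 1, one_pos, Eventually.of_forall fun _ => ⟨le_rfl, le_rfl⟩⟩

/-- The random variable `r X`, for a constant `r > 0`. -/
noncomputable def scale (r : ℝ) (hr : 0 < r) (X : LInfPP P) : LInfPP P :=
  ofFun (fun ω => r * X ω) (X.aestronglyMeasurable.const_mul r) (by
    obtain ⟨c, C, hc, -, h⟩ := X.exists_bounds
    refine ⟨r * c, r * C, mul_pos hr hc, ?_⟩
    filter_upwards [h] with ω hω
    exact ⟨mul_le_mul_of_nonneg_left hω.1 hr.le, mul_le_mul_of_nonneg_left hω.2 hr.le⟩)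

/-- The random variable `X ^ t * Y ^ (1 - t)`, for `t ∈ (0, 1)`. -/
noncomputable def geomMean (t : ℝ) (ht : t ∈ Set.Ioo (0 : ℝ) 1) (X Y : LInfPP P) : LInfPP P :=
  ofFun (fun ω => X ω ^ t * Y ω ^ (1 - t))
    ((X.aestronglyMeasurable.aemeasurable.pow_const t).mul
      (Y.aestronglyMeasurable.aemeasurable.pow_const (1 - t))).aestronglyMeasurable (by
    obtain ⟨c, C, hc, hC, h⟩ := X.exists_bounds
    obtain ⟨d, D, hd, hD, h'⟩ := Y.exists_bounds
    have ht1 : 0 ≤ 1 - t := sub_nonneg.2 ht.2.le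
    refine ⟨c ^ t * d ^ (1 - t), C ^ t * D ^ (1 - t), by positivity, ?_⟩
    filter_upwards [h, h'] with ω h1 h2
    have hX : 0 ≤ X ω := hc.le.trans h1.1
    have hY : 0 ≤ Y ω := hd.le.trans h2.1
    exact ⟨mul_le_mul (Real.rpow_le_rpow hc.le h1.1 ht.1.le)
        (Real.rpow_le_rpow hd.le h2.1 ht1) (by positivity) (by positivity),
      mul_le_mul (Real.rpow_le_rpow hX h1.2 ht.1.le)
        (Real.rpow_le_rpow hY h2.2 ht1) (by positivity) (by positivity)⟩)

end LInfPP

/-- A return risk measure `ρ : L^∞_{++} → (0, ∞)`: positively homogeneous, monotone and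
normalized by `ρ(1) = 1`. -/
structure IsReturnRiskMeasure {P : Measure Ω} (ρ : LInfPP P → ℝ) : Prop where
  pos : ∀ X, 0 < ρ X
  mono : ∀ X Y : LInfPP P, X ≤ᵐ[P] Y → ρ X ≤ ρ Y
  pos_hom : ∀ (r : ℝ) (hr : 0 < r) (X : LInfPP P), ρ (LInfPP.scale r hr X) = r * ρ X
  map_one : ρ LInfPP.one = 1

/-- Geometric (GG-) convexity. -/
def IsGGConvex {P : Measure Ω} (ρ : LInfPP P → ℝ) : Prop :=
  ∀ (X Y : LInfPP P) (t : ℝ) (ht : t ∈ Set.Ioo (0 : ℝ) 1),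
    ρ (LInfPP.geomMean t ht X Y) ≤ ρ X ^ t * ρ Y ^ (1 - t)

/-- `X_n → X` in probability, `‖X_n‖_∞ ≤ k` and `X_n ≥ c > 0` for constants `k`, `c`. -/
def LowerBoundedConv {P : Measure Ω} (Xs : ℕ → LInfPP P) (X : LInfPP P) : Prop :=
  TendstoInMeasure P (fun n => (Xs n : Ω → ℝ)) atTop X ∧
    (∃ k : ℝ, ∀ n, ‖(Xs n).1‖ ≤ k) ∧
    ∃ c : ℝ, 0 < c ∧ ∀ n, ∀ᵐ ω ∂P, c ≤ Xs n ω

/-- The lower-bounded Fatou property. -/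
def LowerBoundedFatou {P : Measure Ω} (ρ : LInfPP P → ℝ) : Prop :=
  ∀ (Xs : ℕ → LInfPP P) (X : LInfPP P), LowerBoundedConv Xs X →
    ((ρ X : ℝ) : EReal) ≤ liminf (fun n => ((ρ (Xs n) : ℝ) : EReal)) atTop

/-- The lower-bounded Lebesgue property. -/
def LowerBoundedLebesgue {P : Measure Ω} (ρ : LInfPP P → ℝ) : Prop :=
  ∀ (Xs : ℕ → LInfPP P) (X : LInfPP P), LowerBoundedConv Xs X →
    Tendsto (fun n => ρ (Xs n)) atTop (𝓝 (ρ X))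

/-- Law invariance: `ρ(X)` depends only on the distribution of `X` under `P`. -/
def LawInvariant {P : Measure Ω} (ρ : LInfPP P → ℝ) : Prop :=
  ∀ X Y : LInfPP P, IdentDistrib X Y P P → ρ X = ρ Y

/-- The multiplicative acceptance set `B_ρ`. -/
def acceptanceSet {P : Measure Ω} (ρ : LInfPP P → ℝ) : Set (LInfPP P) := {X | ρ X ≤ 1}

/-- The probability measures that are absolutely continuous with respect to `P`. -/
def AbsContProb (P : Measure Ω) : Type _ := {Q : ProbabilityMeasure Ω // (Q : Measure Ω) ≪ P}

/-- The density `φ_Q = dQ/dP`, as a real random variable. -/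
noncomputable def density {P : Measure Ω} (Q : AbsContProb P) (ω : Ω) : ℝ :=
  ((Q.1 : Measure Ω).rnDeriv P ω).toReal

/-- The geometric mean `exp (E_Q[log X])`, as an extended nonnegative real. -/
noncomputable def expMeanLog {P : Measure Ω} (Q : AbsContProb P) (X : LInfPP P) : ℝ≥0∞ :=
  ENNReal.ofReal (Real.exp (∫ ω, Real.log (X ω) ∂(Q.1 : Measure Ω)))

/-- `α(Q) = [sup_{X ∈ B_ρ} exp (E_Q[log X])]⁻¹`, with the convention `1 / ∞ = 0`. -/
noncomputable def alpha {P : Measure Ω} (ρ : LInfPP P → ℝ) (Q : AbsContProb P) : ℝ≥0∞ :=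
  (⨆ X ∈ acceptanceSet ρ, expMeanLog Q X)⁻¹

/-- `q` is a version of the quantile function on `(0, 1)` of the random variable `Z` under `P`:
`P(Z < q(t)) ≤ t ≤ P(Z ≤ q(t))` for every `t ∈ (0, 1)`. -/
def IsQuantileFunction (P : Measure Ω) (Z : Ω → ℝ) (q : ℝ → ℝ) : Prop :=
  ∀ t ∈ Set.Ioo (0 : ℝ) 1, P.real {ω | Z ω < q t} ≤ t ∧ t ≤ P.real {ω | Z ω ≤ q t}

/-- Every real random variable has a quantile function. -/
theorem exists_isQuantileFunction (P : Measure Ω) [IsProbabilityMeasure P] (Z : Ω → ℝ)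
    (hZ : AEMeasurable Z P) : ∃ q : ℝ → ℝ, IsQuantileFunction P Z q := by
  have hμ : IsProbabilityMeasure (P.map Z) := Measure.isProbabilityMeasure_map hZ
  have hF : ∀ x, P.real {ω | Z ω ≤ x} = cdf (P.map Z) x := fun x => by
    rw [cdf_eq_real, map_measureReal_apply_of_aemeasurable hZ measurableSet_Iic]
    rfl
  refine ⟨fun t => sInf {x | t ≤ cdf (P.map Z) x}, fun t ht => ?_⟩
  set S : Set ℝ := {x | t ≤ cdf (P.map Z) x} with hS
  have hne : S.Nonempty :=
    (((tendsto_cdf_atTop (P.map Z)).eventually (lt_mem_nhds ht.2)).exists).imp fun _ h => h.le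
  obtain ⟨b, hb⟩ := ((tendsto_cdf_atBot (P.map Z)).eventually (gt_mem_nhds ht.1)).exists
  have hbdd : BddBelow S := ⟨b, fun x hx => le_of_not_gt fun hxb =>
    absurd (((cdf (P.map Z)).mono hxb.le).trans_lt hb) (not_lt.2 hx)⟩
  constructor
  · have h1 : P.real {ω | Z ω < sInf S} = (P.map Z).real (Set.Iio (sInf S)) := by
      rw [map_measureReal_apply_of_aemeasurable hZ measurableSet_Iio]
      rfl
    have h2 : (P.map Z) (Set.Iio (sInf S)) ≤ ENNReal.ofReal t := by
      rw [← measure_cdf (P.map Z), StieltjesFunction.measure_Iio _ (tendsto_cdf_atBot _), sub_zero]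
      refine ENNReal.ofReal_le_ofReal ?_
      refine le_of_tendsto ((cdf (P.map Z)).mono.tendsto_leftLim (sInf S)) ?_
      filter_upwards [self_mem_nhdsWithin] with y hy
      exact (not_le.1 fun h => absurd (csInf_le hbdd h) (not_le.2 hy)).le
    rw [h1]
    exact ENNReal.toReal_le_of_le_ofReal ht.1.le h2
  · rw [hF]
    refine ge_of_tendsto
      (((cdf (P.map Z)).right_continuous (sInf S)).mono Set.Ioi_subset_Ici_self) ?_
    filter_upwards [self_mem_nhdsWithin] with y hy
    obtain ⟨x, hx, hxy⟩ := exists_lt_of_csInf_lt hne hy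
    exact le_trans hx ((cdf (P.map Z)).mono hxy.le)

/-- `exp (∫₀¹ q(t) r(t) dt)`, as an extended nonnegative real. -/
noncomputable def expQuantileIntegral (q r : ℝ → ℝ) : ℝ≥0∞ :=
  ENNReal.ofReal (Real.exp (∫ t in Set.Ioo (0 : ℝ) 1, q t * r t))

end ReturnRisk

/-!
# Dual representation of geometrically convex return risk measures

Taking logarithms turns a geometrically convex return risk measure `ρ` into `φ U = log ρ(exp U)`,
a monotone, cash additive, convex functional on `L^∞` (`logRisk`, `isConvexMonetary_logRisk`), and
`α(Q) exp E_Q[log X]` becomes the exponential of `E_Q[U] - sup {E_Q[V] | φ V ≤ 0}` at `U = log X`.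
That `ρ` dominates these values is immediate, since `X / ρ(X)` is acceptable. For the converse one
has to find, for every `m < φ U₀` and, under the Lebesgue property, for `m = φ U₀`, some `Q ≪ P`
with `E_Q[V] + m ≤ E_Q[U₀]` whenever `φ V ≤ 0`. A continuous positive linear functional on `L^∞`
with this property is provided by the Hahn-Banach theorem; the point is to make it countably
additive. The criterion used is that it stays bounded along `r • 1_{A n}`, with a bound
independent of `r`, whenever `A n` decreases to `∅` (`exists_absContProb_of_eventually_le`).

* Under the Lebesgue property one separates `{φ < φ U₀}` from `U₀` itself. As
  `φ (r • 1_{A n}) → 0` for every `r`, the criterion holds, and the supremum is attained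
  (`exists_absContProb_supporting`).
* Under the Fatou property, let `m < φ U₀` and `C = {W | φ (U₀ - W) ≤ m}`. Following the proof of
  the Krein-Smulian theorem, positive numbers `ε j` are chosen one after the other such that no
  `W ∈ C` satisfies `E[(W - δ - j)⁺] ≤ ε j` for all `j` (`exists_excess_bounds`). The induction step
  is a compactness argument: decreasing convex sets of uniformly bounded random variables contain
  an almost surely convergent selection (`exists_mem_ae_tendsto_of_antitone`), to which the Fatou
  property applies. The set `G` of all `W` that satisfy these inequalities is a neighbourhood of
  `0` and of `r • 1_{A n}` for large `n`, so that the functional separating `G` from `C` meets the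
  criterion (`exists_absContProb_of_lt`).

For the quantile formulas, the layer cake formula gives the Hardy-Littlewood inequality
`E[f g] ≤ E[f' g']` for a comonotone pair `(f', g')` with the marginal laws of `(f, g)`
(`integral_mul_le_of_comonotone`). Quantile functions on `(0, 1)` form such a pair. On a nonatomic
space equality is reached by a rearrangement of `log X` that is comonotone with `dQ/dP`
(`exists_identDistrib_comonotone`): a maximal chain of events through the level sets of `dQ/dP`
contains events of every probability (`exists_measure_eq_of_isMaxChain`), which serve as level
sets of the rearrangement. Law invariance makes `ρ` blind to the rearrangement.
-/

namespace ReturnRisk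

variable {Ω : Type*} [MeasurableSpace Ω] {P : Measure Ω}

section

/-! ### Bounded random variables -/

theorem norm_le_iff_ae (U : Lp ℝ ∞ P) {C : ℝ} (hC : 0 ≤ C) : ‖U‖ ≤ C ↔ ∀ᵐ ω ∂P, |U ω| ≤ C := by
  constructor
  · intro h
    have := ae_le_lpNorm_exponent_top (Lp.memLp U)
    rw [← toReal_eLpNorm (Lp.aestronglyMeasurable U), ← Lp.norm_def] at this
    filter_upwards [this] with ω hω
    exact hω.trans h
  · intro h
    rw [Lp.norm_def]
    refine ENNReal.toReal_le_of_le_ofReal hC ?_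
    rw [eLpNorm_exponent_top]
    exact eLpNormEssSup_le_of_ae_bound h

theorem ae_abs_le_norm (U : Lp ℝ ∞ P) : ∀ᵐ ω ∂P, |U ω| ≤ ‖U‖ :=
  (norm_le_iff_ae U (norm_nonneg _)).1 le_rfl

section FiniteMeasure

variable [IsFiniteMeasure P]

theorem le_const_of_norm_le (U : Lp ℝ ∞ P) {C : ℝ} (h : ‖U‖ ≤ C) : U ≤ Lp.const ∞ P C := by
  rw [← Lp.coeFn_le]
  filter_upwards [ae_abs_le_norm U, Lp.coeFn_const ∞ P C] with ω h1 h2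
  rw [h2]
  exact (le_abs_self _).trans (h1.trans h)

theorem const_eq_smul (c : ℝ) : Lp.const ∞ P c = c • Lp.const ∞ P (1 : ℝ) := by
  simpa using (Lp.constₗ ∞ P ℝ).map_smul c (1 : ℝ)

/-- The indicator of an event, as an element of `L^∞`. -/
noncomputable def eventInd (P : Measure Ω) [IsFiniteMeasure P] {A : Set Ω} (hA : MeasurableSet A) :
    Lp ℝ ∞ P :=
  indicatorConstLp ∞ hA (measure_ne_top P A) (1 : ℝ)

theorem coeFn_eventInd {A : Set Ω} (hA : MeasurableSet A) :
    eventInd P hA =ᵐ[P] A.indicator fun _ => 1 :=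
  indicatorConstLp_coeFn

theorem eventInd_nonneg {A : Set Ω} (hA : MeasurableSet A) : 0 ≤ eventInd P hA := by
  rw [← Lp.coeFn_nonneg]
  filter_upwards [coeFn_eventInd (P := P) hA] with ω h
  rw [h]
  exact Set.indicator_nonneg (fun _ _ => zero_le_one) ω

theorem eventInd_union {A B C : Set Ω} (hA : MeasurableSet A) (hB : MeasurableSet B)
    (hC : MeasurableSet C) (h : A = B ∪ C) (hd : Disjoint B C) :
    eventInd P hA = eventInd P hB + eventInd P hC := by
  subst h
  exact indicatorConstLp_disjoint_union hB hC _ _ hd 1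

theorem eventInd_univ : eventInd P MeasurableSet.univ = Lp.const ∞ P (1 : ℝ) :=
  indicatorConstLp_univ _ _ _

theorem eventInd_of_measure_zero {A : Set Ω} (hA : MeasurableSet A) (h : P A = 0) :
    eventInd P hA = 0 := by
  refine Lp.ext ?_
  filter_upwards [coeFn_eventInd (P := P) hA, Lp.coeFn_zero ℝ ∞ P,
    measure_eq_zero_iff_ae_notMem.1 h] with ω h1 h2 h3
  rw [h1, h2]
  simp [h3]

/-! ### Countably additive positive functionals on `L^∞` -/

section Functional

variable {f : StrongDual ℝ (Lp ℝ ∞ P)}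

theorem le_norm_mul_of_nonneg (hf : ∀ U, 0 ≤ U → 0 ≤ f U) (U : Lp ℝ ∞ P) :
    f U ≤ ‖U‖ * f (Lp.const ∞ P (1 : ℝ)) := by
  have h := hf _ (sub_nonneg.2 (le_const_of_norm_le U le_rfl))
  rw [map_sub, const_eq_smul, map_smul, smul_eq_mul] at h
  linarith

theorem tendsto_eventInd_of_bounded (hf : ∀ U, 0 ≤ U → 0 ≤ f U) {K : ℝ}
    {A : ℕ → Set Ω} (hA : ∀ n, MeasurableSet (A n))
    (hK : ∀ r : ℝ, 0 < r → ∀ᶠ n in atTop, f (r • eventInd P (hA n)) ≤ K) :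
    Tendsto (fun n => f (eventInd P (hA n))) atTop (𝓝 0) := by
  rw [Metric.tendsto_nhds]
  intro ε hε
  have hr : 0 < (|K| + 1) / ε := by positivity
  filter_upwards [hK _ hr] with n hn
  rw [map_smul, smul_eq_mul] at hn
  rw [dist_zero_right, Real.norm_of_nonneg (hf _ (eventInd_nonneg _))]
  have h1 : (|K| + 1) / ε * f (eventInd P (hA n)) < |K| + 1 :=
    lt_of_le_of_lt (hn.trans (le_abs_self K)) (lt_add_one _)
  rw [div_mul_eq_mul_div, div_lt_iff₀ hε] at h1
  exact lt_of_mul_lt_mul_left h1 (by positivity)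

theorem hasSum_eventInd (hf : ∀ U, 0 ≤ U → 0 ≤ f U)
    (hcont : ∀ (A : ℕ → Set Ω) (hA : ∀ n, MeasurableSet (A n)), Antitone A → ⋂ n, A n = ∅ →
      Tendsto (fun n => f (eventInd P (hA n))) atTop (𝓝 0))
    {A : ℕ → Set Ω} (hA : ∀ n, MeasurableSet (A n)) (hd : Pairwise (Function.onFun Disjoint A)) :
    HasSum (fun n => f (eventInd P (hA n))) (f (eventInd P (MeasurableSet.iUnion hA))) := by
  -- the tails `T n` decrease to `∅`, and the partial sums are `f (1_{T 0}) - f (1_{T n})`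
  set T : ℕ → Set Ω := fun n => ⋃ i, A (n + i) with hT
  have hTm : ∀ n, MeasurableSet (T n) := fun n => MeasurableSet.iUnion fun i => hA _
  have hsucc : ∀ n, T n = A n ∪ T (n + 1) := by
    intro n
    ext ω
    simp only [hT, Set.mem_iUnion, Set.mem_union]
    constructor
    · rintro ⟨i, hi⟩
      rcases i with _ | i
      · exact Or.inl hi
      · exact Or.inr ⟨i, by rwa [add_assoc, add_comm 1 i]⟩
    · rintro (h | ⟨i, hi⟩)
      · exact ⟨0, h⟩
      · exact ⟨i + 1, by rwa [add_assoc, add_comm 1 i] at hi⟩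
  have hdisj : ∀ n, Disjoint (A n) (T (n + 1)) := by
    intro n
    simp only [hT, Set.disjoint_iUnion_right]
    exact fun i => hd (by omega)
  have hanti : Antitone T := antitone_nat_of_succ_le fun n => by
    rw [hsucc n]
    exact Set.subset_union_right
  have hinter : ⋂ n, T n = ∅ := by
    refine Set.eq_empty_of_forall_notMem fun ω hω => ?_
    rw [Set.mem_iInter] at hω
    obtain ⟨i, hi⟩ := Set.mem_iUnion.1 (hω 0)
    exact Set.disjoint_left.1 (hdisj (0 + i)) hi (hω _)
  have hsum : ∀ n, ∑ i ∈ Finset.range n, f (eventInd P (hA i)) =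
      f (eventInd P (hTm 0)) - f (eventInd P (hTm n)) := by
    intro n
    induction n with
    | zero => simp
    | succ n ih =>
      rw [Finset.sum_range_succ, ih,
        eventInd_union (hTm n) (hA n) (hTm (n + 1)) (hsucc n) (hdisj n), map_add]
      ring
  rw [hasSum_iff_tendsto_nat_of_nonneg fun i => hf _ (eventInd_nonneg _)]
  simp_rw [hsum]
  have h0 : eventInd P (hTm 0) = eventInd P (MeasurableSet.iUnion hA) := by
    congr 1
    simp [hT]
  rw [← h0]
  simpa using (hcont T hTm hanti hinter).const_sub (f (eventInd P (hTm 0)))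

end Functional

end FiniteMeasure

/-- Bounded random variables are uniform limits of simple ones. -/
theorem exists_simpleFunc_norm_sub_le (U : Lp ℝ ∞ P) {ε : ℝ} (hε : 0 < ε) :
    ∃ s : SimpleFunc Ω ℝ, ‖U - (s.memLp_top P).toLp s‖ ≤ ε := by
  set C := ‖U‖
  -- `U`, truncated to `[-C, C]` and rounded down to a multiple of `ε`
  let g : Ω → ℤ := fun ω => ⌊max (-C) (min C (U ω)) / ε⌋
  have hUm : Measurable U := (Lp.stronglyMeasurable U).measurable
  have hg : Measurable g :=
    ((measurable_const.max (measurable_const.min hUm)).div_const ε).floor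
  have hfin : (Set.range fun ω => (g ω : ℝ) * ε).Finite := by
    have : (Set.range fun ω => (g ω : ℝ) * ε) ⊆
        (fun n : ℤ => (n : ℝ) * ε) '' Set.Icc ⌊-C / ε⌋ ⌊C / ε⌋ := by
      rintro _ ⟨ω, rfl⟩
      refine ⟨g ω, ⟨Int.floor_le_floor ?_, Int.floor_le_floor ?_⟩, rfl⟩
      · gcongr
        exact le_max_left _ _
      · gcongr
        exact max_le (by linarith [norm_nonneg U]) (min_le_left _ _)
    exact ((Set.finite_Icc _ _).image _).subset this
  have hgm : Measurable fun ω => (g ω : ℝ) * ε := by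
    have : Measurable fun ω => ((g ω : ℤ) : ℝ) := measurable_from_top.comp hg
    exact this.mul_const ε
  refine ⟨⟨fun ω => g ω * ε, fun x => hgm (measurableSet_singleton x), hfin⟩, ?_⟩
  rw [norm_le_iff_ae _ hε.le]
  filter_upwards [Lp.coeFn_sub U (MemLp.toLp _ (SimpleFunc.memLp_top
    ⟨fun ω => g ω * ε, fun x => hgm (measurableSet_singleton x), hfin⟩ P)),
    MemLp.coeFn_toLp (SimpleFunc.memLp_top
    ⟨fun ω => g ω * ε, fun x => hgm (measurableSet_singleton x), hfin⟩ P),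
    ae_abs_le_norm U] with ω h1 h2 h3
  rw [h1, Pi.sub_apply, h2]
  change |U ω - g ω * ε| ≤ ε
  have hg' : g ω = ⌊U ω / ε⌋ := by
    have := abs_le.1 h3
    simp only [g]
    rw [min_eq_right this.2, max_eq_right this.1]
  have e1 := Int.floor_le (U ω / ε)
  have e2 := Int.lt_floor_add_one (U ω / ε)
  rw [← hg', le_div_iff₀ hε] at e1
  rw [← hg', div_lt_iff₀ hε] at e2
  rw [abs_le]
  constructor <;> linarith

theorem measurable_density (Q : AbsContProb P) : Measurable (density Q) :=
  (Measure.measurable_rnDeriv _ _).ennreal_toReal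

theorem integrable_density (Q : AbsContProb P) : Integrable (density Q) P :=
  Measure.integrable_toReal_rnDeriv

theorem integrable_of_absCont (Q : AbsContProb P) (U : Lp ℝ ∞ P) :
    Integrable U (Q.1 : Measure Ω) :=
  Integrable.of_bound ((Lp.aestronglyMeasurable U).mono_ac Q.2) ‖U‖ (Q.2.ae_le (ae_abs_le_norm U))

/-- Expectation under `Q ≪ P`, as a linear functional on `L^∞(P)`. -/
noncomputable def expectation (Q : AbsContProb P) : Lp ℝ ∞ P →ₗ[ℝ] ℝ where
  toFun U := ∫ ω, U ω ∂(Q.1 : Measure Ω)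
  map_add' U V := by
    rw [← integral_add (integrable_of_absCont Q U) (integrable_of_absCont Q V)]
    exact integral_congr_ae (Q.2.ae_le (Lp.coeFn_add U V))
  map_smul' c U := by
    rw [RingHom.id_apply, smul_eq_mul, ← integral_const_mul]
    exact integral_congr_ae (Q.2.ae_le (Lp.coeFn_smul c U))

theorem expectation_apply (Q : AbsContProb P) (U : Lp ℝ ∞ P) :
    expectation Q U = ∫ ω, U ω ∂(Q.1 : Measure Ω) := rfl

theorem abs_expectation_le (Q : AbsContProb P) (U : Lp ℝ ∞ P) : |expectation Q U| ≤ ‖U‖ := by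
  have h : ∀ᵐ ω ∂(Q.1 : Measure Ω), ‖U ω‖ ≤ ‖U‖ := Q.2.ae_le (ae_abs_le_norm U)
  simpa [expectation_apply] using norm_integral_le_of_norm_le_const h

variable [IsProbabilityMeasure P]

theorem expectation_const (Q : AbsContProb P) (c : ℝ) : expectation Q (Lp.const ∞ P c) = c := by
  rw [expectation_apply, integral_congr_ae (Q.2.ae_le (Lp.coeFn_const ∞ P c))]
  simp

theorem expectation_eventInd (Q : AbsContProb P) {A : Set Ω} (hA : MeasurableSet A) :
    expectation Q (eventInd P hA) = (Q.1 : Measure Ω).real A := by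
  rw [expectation_apply, integral_congr_ae (Q.2.ae_le (coeFn_eventInd hA)),
    integral_indicator_const _ hA]
  simp

theorem eq_expectation_of_eventInd {f : StrongDual ℝ (Lp ℝ ∞ P)}
    (Q : AbsContProb P) (hQ : ∀ (A : Set Ω) (hA : MeasurableSet A),
      f (eventInd P hA) = (Q.1 : Measure Ω).real A) (U : Lp ℝ ∞ P) : f U = expectation Q U := by
  have hsimple : ∀ s : SimpleFunc Ω ℝ, f ((s.memLp_top P).toLp s) =
      expectation Q ((s.memLp_top P).toLp s) := by
    intro s
    induction s using SimpleFunc.induction with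
    | @const c A hA =>
      have : (MemLp.toLp _ (SimpleFunc.memLp_top ((SimpleFunc.piecewise A hA
          (SimpleFunc.const Ω c) (SimpleFunc.const Ω 0))) P)) = c • eventInd P hA := by
        refine Lp.ext ?_
        filter_upwards [MemLp.coeFn_toLp (SimpleFunc.memLp_top ((SimpleFunc.piecewise A hA
          (SimpleFunc.const Ω c) (SimpleFunc.const Ω 0))) P), coeFn_eventInd (P := P) hA,
          Lp.coeFn_smul c (eventInd P hA)] with ω h1 h2 h3
        rw [h1, h3, Pi.smul_apply, h2]
        by_cases h : ω ∈ A <;> simp [h]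
      rw [this, map_smul, map_smul, hQ, expectation_eventInd]
    | @add s t hst hs ht =>
      have : (MemLp.toLp _ (SimpleFunc.memLp_top (s + t) P)) =
          (s.memLp_top P).toLp s + (t.memLp_top P).toLp t :=
        MemLp.toLp_add (s.memLp_top P) (t.memLp_top P)
      rw [this, map_add, map_add, hs, ht]
  have hlim : ∀ ε : ℝ, 0 < ε → |f U - expectation Q U| ≤ (‖f‖ + 1) * ε := by
    intro ε hε
    obtain ⟨s, hs⟩ := exists_simpleFunc_norm_sub_le U hε
    have h1 := (f.le_opNorm (U - (s.memLp_top P).toLp s)).trans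
      (mul_le_mul_of_nonneg_left hs (norm_nonneg f))
    have h2 := (abs_expectation_le Q (U - (s.memLp_top P).toLp s)).trans hs
    rw [map_sub, hsimple s, Real.norm_eq_abs] at h1
    rw [map_sub] at h2
    rw [abs_le] at h1 h2 ⊢
    constructor <;> linarith [h1.1, h1.2, h2.1, h2.2]
  have h0 : |f U - expectation Q U| ≤ 0 := by
    refine le_of_forall_pos_le_add fun ε hε => ?_
    have := hlim (ε / (‖f‖ + 1)) (by positivity)
    rwa [mul_div_cancel₀ _ (by positivity : ‖f‖ + 1 ≠ 0), ← zero_add ε] at this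
  exact sub_eq_zero.1 (abs_nonpos_iff.1 h0)

theorem exists_absContProb_of_map_one {f : StrongDual ℝ (Lp ℝ ∞ P)}
    (hf : ∀ U, 0 ≤ U → 0 ≤ f U) (h1 : f (Lp.const ∞ P (1 : ℝ)) = 1)
    (hcont : ∀ (A : ℕ → Set Ω) (hA : ∀ n, MeasurableSet (A n)), Antitone A → ⋂ n, A n = ∅ →
      Tendsto (fun n => f (eventInd P (hA n))) atTop (𝓝 0)) :
    ∃ Q : AbsContProb P, ∀ U, f U = expectation Q U := by
  let μ : Measure Ω := Measure.ofMeasurable (fun A hA => ENNReal.ofReal (f (eventInd P hA)))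
    (by rw [eventInd_of_measure_zero _ measure_empty, map_zero, ENNReal.ofReal_zero])
    (fun A hA hd => by
      have hs := hasSum_eventInd hf hcont hA hd
      rw [← hs.tsum_eq, ENNReal.ofReal_tsum_of_nonneg (fun n => hf _ (eventInd_nonneg _))
        hs.summable])
  have hμ : ∀ A (hA : MeasurableSet A), μ A = ENNReal.ofReal (f (eventInd P hA)) :=
    fun A hA => Measure.ofMeasurable_apply A hA
  have hprob : IsProbabilityMeasure μ := ⟨by
    rw [hμ _ MeasurableSet.univ, eventInd_univ, h1, ENNReal.ofReal_one]⟩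
  have hac : μ ≪ P := Measure.AbsolutelyContinuous.mk fun A hA h0 => by
    rw [hμ A hA, eventInd_of_measure_zero hA h0, map_zero, ENNReal.ofReal_zero]
  refine ⟨⟨⟨μ, hprob⟩, hac⟩, eq_expectation_of_eventInd _ fun A hA => ?_⟩
  change _ = μ.real A
  rw [Measure.real, hμ A hA, ENNReal.toReal_ofReal (hf _ (eventInd_nonneg hA))]

/-- A positive functional on `L^∞` that stays bounded, eventually and uniformly in `r`, along
`r • 1_{A n}` whenever `A n` decreases to `∅` is, up to a factor, the expectation under some
`Q ≪ P`. -/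
theorem exists_absContProb_of_eventually_le {f : StrongDual ℝ (Lp ℝ ∞ P)}
    (hf : ∀ U, 0 ≤ U → 0 ≤ f U) (h1 : 0 < f (Lp.const ∞ P (1 : ℝ))) (K : ℝ)
    (hK : ∀ (A : ℕ → Set Ω) (hA : ∀ n, MeasurableSet (A n)), Antitone A → ⋂ n, A n = ∅ →
      ∀ r : ℝ, 0 < r → ∀ᶠ n in atTop, f (r • eventInd P (hA n)) ≤ K) :
    ∃ Q : AbsContProb P, ∀ U, f U = f (Lp.const ∞ P (1 : ℝ)) * expectation Q U := by
  set a := f (Lp.const ∞ P (1 : ℝ)) with ha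
  obtain ⟨Q, hQ⟩ := exists_absContProb_of_map_one (f := a⁻¹ • f)
    (fun U hU => mul_nonneg (inv_nonneg.2 h1.le) (hf U hU)) (inv_mul_cancel₀ h1.ne')
    (fun A hA hanti hinter => by
      simpa using (tendsto_eventInd_of_bounded hf hA (hK A hA hanti hinter)).const_mul a⁻¹)
  refine ⟨Q, fun U => ?_⟩
  rw [← hQ U]
  exact (mul_inv_cancel_left₀ h1.ne' _).symm

end

section

/-! ### Convex monetary functionals on `L^∞` -/

/-- A convex monetary functional on `L^∞`: monotone, cash additive, convex and vanishing at `0`. -/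
structure IsConvexMonetary [IsFiniteMeasure P] (φ : Lp ℝ ∞ P → ℝ) : Prop where
  mono : Monotone φ
  add_const : ∀ U (c : ℝ), φ (U + Lp.const ∞ P c) = φ U + c
  convex : ConvexOn ℝ Set.univ φ
  map_zero : φ 0 = 0

variable [IsProbabilityMeasure P] {φ : Lp ℝ ∞ P → ℝ}

namespace IsConvexMonetary

theorem map_const (hφ : IsConvexMonetary φ) (c : ℝ) : φ (Lp.const ∞ P c) = c := by
  simpa [hφ.map_zero] using hφ.add_const 0 c

theorem le_add_norm (hφ : IsConvexMonetary φ) (U V : Lp ℝ ∞ P) : φ U ≤ φ V + ‖U - V‖ := by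
  rw [← hφ.add_const]
  refine hφ.mono ?_
  rw [add_comm]
  exact sub_le_iff_le_add.1 (le_const_of_norm_le _ le_rfl)

theorem continuous (hφ : IsConvexMonetary φ) : Continuous φ := by
  refine (LipschitzWith.of_le_add_mul 1 fun U V => ?_).continuous
  rw [dist_eq_norm, NNReal.coe_one, one_mul]
  exact hφ.le_add_norm U V

end IsConvexMonetary

theorem ae_tendsto_smul_eventInd {A : ℕ → Set Ω} (hA : ∀ n, MeasurableSet (A n))
    (hanti : Antitone A) (hinter : ⋂ n, A n = ∅) (r c : ℝ) :
    ∀ᵐ ω ∂P, Tendsto (fun n => (r • eventInd P (hA n) + Lp.const ∞ P c : Lp ℝ ∞ P) ω) atTop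
      (𝓝 ((Lp.const ∞ P c : Lp ℝ ∞ P) ω)) := by
  have h1 : ∀ᵐ ω ∂P, ∀ n, (r • eventInd P (hA n) + Lp.const ∞ P c : Lp ℝ ∞ P) ω =
      r * (A n).indicator (fun _ => (1 : ℝ)) ω + c := by
    rw [ae_all_iff]
    intro n
    filter_upwards [Lp.coeFn_add (r • eventInd P (hA n)) (Lp.const ∞ P c),
      Lp.coeFn_smul r (eventInd P (hA n)), coeFn_eventInd (P := P) (hA n),
      Lp.coeFn_const ∞ P c] with ω h1 h2 h3 h4
    rw [h1, Pi.add_apply, h2, Pi.smul_apply, h3, h4]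
    rfl
  filter_upwards [h1, Lp.coeFn_const ∞ P c] with ω h1 h2
  simp_rw [h1]
  rw [h2]
  obtain ⟨N, hN⟩ : ∃ N, ω ∉ A N := by
    by_contra! h
    exact Set.notMem_empty ω (hinter ▸ Set.mem_iInter.2 h)
  refine tendsto_const_nhds.congr' ?_
  filter_upwards [eventually_ge_atTop N] with n hn
  simp [Set.indicator_of_notMem fun h => hN (hanti hn h)]

theorem norm_eventInd_le {A : Set Ω} (hA : MeasurableSet A) : ‖eventInd P hA‖ ≤ 1 := by
  rw [norm_le_iff_ae _ zero_le_one]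
  filter_upwards [coeFn_eventInd (P := P) hA] with ω h
  rw [h]
  by_cases hω : ω ∈ A <;> simp [hω]

theorem norm_const_le_abs (c : ℝ) : ‖Lp.const ∞ P c‖ ≤ |c| := by
  rw [norm_le_iff_ae _ (abs_nonneg c)]
  filter_upwards [Lp.coeFn_const ∞ P c] with ω h
  rw [h]
  rfl

theorem apply_const_one_pos {f : StrongDual ℝ (Lp ℝ ∞ P)} (hf : ∀ U, 0 ≤ U → 0 ≤ f U)
    {U : Lp ℝ ∞ P} (hU : 0 < f U) : 0 < f (Lp.const ∞ P (1 : ℝ)) :=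
  pos_of_mul_pos_right (hU.trans_le (le_norm_mul_of_nonneg hf U)) (norm_nonneg U)

theorem nonneg_of_forall_nat_mul_le {a b : ℝ} (h : ∀ n : ℕ, b ≤ n * a) : 0 ≤ a := by
  by_contra! ha
  obtain ⟨n, hn⟩ := exists_nat_gt (b / a)
  rw [div_lt_iff_of_neg ha] at hn
  exact absurd (h n) (not_le.2 hn)

/-- Under the Lebesgue property, the supporting functional of `φ` at `U₀` is countably additive:
for `m = φ U₀` it is obtained by separating the open set `{φ < m}` from `U₀`, and it is bounded
along `r • 1_{A n}`, as `φ (r • 1_{A n} + (m - 1)) → m - 1 < m`. -/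
theorem exists_absContProb_supporting (hφ : IsConvexMonetary φ)
    (hL : ∀ (U : ℕ → Lp ℝ ∞ P) (V : Lp ℝ ∞ P) (C : ℝ), (∀ n, ‖U n‖ ≤ C) →
      (∀ᵐ ω ∂P, Tendsto (fun n => U n ω) atTop (𝓝 (V ω))) →
      Tendsto (fun n => φ (U n)) atTop (𝓝 (φ V))) (U₀ : Lp ℝ ∞ P) :
    ∃ Q : AbsContProb P, ∀ V, φ V ≤ 0 → expectation Q V + φ U₀ ≤ expectation Q U₀ := by
  set m := φ U₀ with hm
  have hconv : Convex ℝ {V | φ V < m} := by simpa using hφ.convex.convex_lt m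
  obtain ⟨f, hf⟩ := geometric_hahn_banach_open_point hconv
    (isOpen_lt hφ.continuous continuous_const) (x := U₀) (lt_irrefl m)
  set a := Lp.const ∞ P (m - 1) with ha
  have ham : φ a < m := by rw [ha, hφ.map_const]; linarith
  have hpos : ∀ Z, 0 ≤ Z → 0 ≤ f Z := by
    intro Z hZ
    refine nonneg_of_forall_nat_mul_le (b := f a - f U₀) fun n => ?_
    have h1 : φ (a - (n : ℝ) • Z) < m := by
      refine (hφ.mono (sub_le_self a ?_)).trans_lt ham
      rw [Nat.cast_smul_eq_nsmul]
      exact nsmul_nonneg hZ n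
    have h2 := hf _ h1
    rw [map_sub, map_smul, smul_eq_mul] at h2
    linarith
  have h1 : 0 < f (Lp.const ∞ P (1 : ℝ)) := by
    refine apply_const_one_pos hpos (U := U₀ - a) ?_
    rw [map_sub]
    linarith [hf a ham]
  obtain ⟨Q, hQ⟩ := exists_absContProb_of_eventually_le hpos h1 (f U₀ - f a) (by
    intro A hA hanti hinter r hr
    have hlim := hL (fun n => r • eventInd P (hA n) + a) a (|r| + |m - 1|) (fun n => by
      refine (norm_add_le _ _).trans (add_le_add ?_ (norm_const_le_abs _))
      rw [norm_smul, Real.norm_eq_abs]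
      exact mul_le_of_le_one_right (abs_nonneg r) (norm_eventInd_le (hA n)))
      (ae_tendsto_smul_eventInd hA hanti hinter r (m - 1))
    filter_upwards [hlim.eventually_lt_const ham] with n hn
    have := hf _ hn
    rw [map_add] at this
    linarith)
  refine ⟨Q, fun V hV => ?_⟩
  refine le_of_forall_pos_le_add fun ε hε => ?_
  have h2 : φ (V + Lp.const ∞ P (m - ε)) < m := by rw [hφ.add_const]; linarith
  have h3 := hf _ h2
  rw [map_add, const_eq_smul, map_smul, smul_eq_mul, hQ V, hQ U₀] at h3
  have h4 : f (Lp.const ∞ P (1 : ℝ)) * (expectation Q V + (m - ε)) <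
      f (Lp.const ∞ P (1 : ℝ)) * expectation Q U₀ := by linarith
  linarith [lt_of_mul_lt_mul_left h4 h1.le]

/-! ### Almost sure limits along decreasing convex sets -/

/-- In an inner product space, elements of almost minimal norm of decreasing bounded convex sets
form a Cauchy sequence: midpoints stay in the larger set, and the parallelogram law applies. -/
theorem exists_cauchySeq_mem_of_antitone {H : Type*} [NormedAddCommGroup H]
    [InnerProductSpace ℝ H] {K : ℕ → Set H} (hanti : Antitone K) (hconv : ∀ n, Convex ℝ (K n))
    (hne : ∀ n, (K n).Nonempty) {C : ℝ} (hC : ∀ n, ∀ x ∈ K n, ‖x‖ ≤ C) :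
    ∃ x : ℕ → H, (∀ n, x n ∈ K n) ∧ CauchySeq x := by
  set d : ℕ → ℝ := fun n => Metric.infDist 0 (K n) with hd
  have hdx : ∀ n, ∀ x ∈ K n, d n ≤ ‖x‖ := fun n x hx => by
    simpa using Metric.infDist_le_dist_of_mem (x := (0 : H)) hx
  have hd0 : ∀ n, 0 ≤ d n := fun n => Metric.infDist_nonneg
  have hmono : Monotone d := fun i j hij => Metric.infDist_le_infDist_of_subset (hanti hij) (hne j)
  have hbdd : BddAbove (Set.range d) := ⟨C, by
    rintro _ ⟨n, rfl⟩
    obtain ⟨x, hx⟩ := hne n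
    exact (hdx n x hx).trans (hC n x hx)⟩
  have hlim := tendsto_atTop_ciSup hmono hbdd
  set D := ⨆ n, d n
  have hdD : ∀ n, d n ≤ D := fun n => le_ciSup hbdd n
  have hex : ∀ n : ℕ, ∃ x ∈ K n, ‖x‖ < d n + 1 / ((n : ℝ) + 1) := fun n => by
    have := (Metric.infDist_lt_iff (x := (0 : H)) (hne n)).1
      (lt_add_of_pos_right (d n) (Nat.one_div_pos_of_nat (α := ℝ) (n := n)))
    simpa using this
  choose x hx hxd using hex
  refine ⟨x, hx, cauchySeq_of_le_tendsto_0
    (fun n : ℕ => √(4 * ((D + 1 / ((n : ℝ) + 1)) ^ 2 - d n ^ 2))) (fun n k N hn hk => ?_) ?_⟩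
  · rw [dist_eq_norm]
    refine Real.le_sqrt_of_sq_le ?_
    have hnorm : ∀ i, N ≤ i → ‖x i‖ ≤ D + 1 / ((N : ℝ) + 1) := fun i hi =>
      (hxd i).le.trans (add_le_add (hdD i) (Nat.one_div_le_one_div hi))
    have hmid := hdx N _ (hconv N (hanti hn (hx n)) (hanti hk (hx k))
      (by norm_num : (0 : ℝ) ≤ 1 / 2)
      (by norm_num : (0 : ℝ) ≤ 1 / 2) (by norm_num))
    rw [← smul_add, norm_smul, Real.norm_of_nonneg (by norm_num)] at hmid
    have hpar := parallelogram_law_with_norm ℝ (x n) (x k)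
    have e1 := pow_le_pow_left₀ (norm_nonneg _) (hnorm n hn) 2
    have e2 := pow_le_pow_left₀ (norm_nonneg _) (hnorm k hk) 2
    have e3 := pow_le_pow_left₀ (hd0 N) hmid 2
    nlinarith [e1, e2, e3, hpar]
  · have h1 : Tendsto (fun n : ℕ => D + 1 / ((n : ℝ) + 1)) atTop (𝓝 (D + 0)) :=
      tendsto_one_div_add_atTop_nhds_zero_nat.const_add D
    have h2 := (((h1.pow 2).sub (hlim.pow 2)).const_mul 4).sqrt
    simpa using h2

/-- Decreasing nonempty convex sets of uniformly bounded random variables contain an a.s.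
convergent selection: elements of almost minimal `L²` norm form an `L²`-Cauchy sequence by the
parallelogram law. -/
theorem exists_mem_ae_tendsto_of_antitone {K : ℕ → Set (Lp ℝ ∞ P)} (hanti : Antitone K)
    (hconv : ∀ n, Convex ℝ (K n)) (hne : ∀ n, (K n).Nonempty) {C : ℝ}
    (hC : ∀ n, ∀ W ∈ K n, ‖W‖ ≤ C) :
    ∃ (W : ℕ → Lp ℝ ∞ P) (V : Lp ℝ ∞ P), (∀ n, W n ∈ K n) ∧
      ∀ᵐ ω ∂P, Tendsto (fun n => W n ω) atTop (𝓝 (V ω)) := by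
  -- the sets `K n`, seen in `L²`
  let K' : ℕ → Set (Lp ℝ 2 P) := fun n => {g | ∃ W ∈ K n, g =ᵐ[P] W}
  have hC0 : 0 ≤ C := by
    obtain ⟨W, hW⟩ := hne 0
    exact (norm_nonneg W).trans (hC 0 W hW)
  obtain ⟨g, hg, hcau⟩ := exists_cauchySeq_mem_of_antitone (K := K') (C := C)
    (fun i j hij g ⟨W, hW, h⟩ => ⟨W, hanti hij hW, h⟩)
    (by
      rintro n g ⟨W, hW, hgW⟩ g' ⟨W', hW', hgW'⟩ s t hs ht hst
      refine ⟨s • W + t • W', hconv n hW hW' hs ht hst, ?_⟩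
      filter_upwards [Lp.coeFn_add (s • g) (t • g'), Lp.coeFn_smul s g, Lp.coeFn_smul t g',
        Lp.coeFn_add (s • W) (t • W'), Lp.coeFn_smul s W, Lp.coeFn_smul t W', hgW, hgW']
        with ω h1 h2 h3 h4 h5 h6 h7 h8
      rw [h1, h4, Pi.add_apply, Pi.add_apply, h2, h3, h5, h6, Pi.smul_apply, Pi.smul_apply,
        Pi.smul_apply, Pi.smul_apply, h7, h8])
    (by
      intro n
      obtain ⟨W, hW⟩ := hne n
      exact ⟨((Lp.memLp W).mono_exponent le_top).toLp W, W, hW, MemLp.coeFn_toLp _⟩)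
    (by
      rintro n g ⟨W, hW, hgW⟩
      have := Lp.norm_le_of_ae_bound (f := g) (C := C) hC0 (by
        filter_upwards [hgW, (norm_le_iff_ae W hC0).1 (hC n W hW)] with ω h1 h2
        rw [h1]
        exact h2)
      simpa [measureUnivNNReal] using this)
  obtain ⟨G, hG⟩ := cauchySeq_tendsto_of_complete hcau
  obtain ⟨ns, hns, hae⟩ := (tendstoInMeasure_of_tendsto_Lp hG).exists_seq_tendsto_ae
  choose W hW hgW using hg
  have hlim : ∀ᵐ ω ∂P, Tendsto (fun n => W (ns n) ω) atTop (𝓝 (G ω)) := by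
    filter_upwards [hae, ae_all_iff.2 hgW] with ω h1 h2
    simpa [h2] using h1
  have hbound : ∀ᵐ ω ∂P, ‖G ω‖ ≤ C := by
    filter_upwards [hlim, ae_all_iff.2 fun n => (norm_le_iff_ae (W n) hC0).1 (hC n _ (hW n))]
      with ω h1 h2
    exact le_of_tendsto' h1.norm fun n => h2 (ns n)
  refine ⟨fun n => W (ns n), (memLp_top_of_bound (Lp.aestronglyMeasurable G) C hbound).toLp G,
    fun n => hanti hns.le_apply (hW _), ?_⟩
  filter_upwards [hlim, (memLp_top_of_bound (Lp.aestronglyMeasurable G) C hbound).coeFn_toLp]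
    with ω h1 h2
  rwa [h2]

end

section

/-! ### Excess over a level -/

/-- The expected excess `E[(W - a)⁺]`. -/
noncomputable def excess (a : ℝ) (W : Lp ℝ ∞ P) : ℝ := ∫ ω, max (W ω - a) 0 ∂P

theorem excess_zero {a : ℝ} (ha : 0 ≤ a) : excess a (0 : Lp ℝ ∞ P) = 0 := by
  rw [excess, integral_congr_ae (g := fun _ => 0), integral_zero]
  filter_upwards [Lp.coeFn_zero ℝ ∞ P] with ω h
  rw [h]
  simpa using ha

variable [IsProbabilityMeasure P] {φ : Lp ℝ ∞ P → ℝ}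

theorem integrable_excess (a : ℝ) (W : Lp ℝ ∞ P) : Integrable (fun ω => max (W ω - a) 0) P :=
  (((Lp.memLp W).integrable le_top).sub (integrable_const a)).pos_part

theorem excess_mono {a b : ℝ} {V W : Lp ℝ ∞ P} (h : ∀ᵐ ω ∂P, V ω - a ≤ W ω - b) :
    excess a V ≤ excess b W := by
  refine integral_mono_ae (integrable_excess a V) (integrable_excess b W) ?_
  filter_upwards [h] with ω hω
  exact max_le_max_right 0 hω

theorem convex_setOf_excess_le (a ε : ℝ) : Convex ℝ {W : Lp ℝ ∞ P | excess a W ≤ ε} := by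
  intro V hV W hW s t hs ht hst
  rw [Set.mem_ofPred_eq] at hV hW ⊢
  calc excess a (s • V + t • W)
      ≤ ∫ ω, s * max (V ω - a) 0 + t * max (W ω - a) 0 ∂P := by
        refine integral_mono_ae (integrable_excess a _)
          (((integrable_excess a V).const_mul s).add ((integrable_excess a W).const_mul t)) ?_
        filter_upwards [Lp.coeFn_add (s • V) (t • W), Lp.coeFn_smul s V, Lp.coeFn_smul t W]
          with ω h1 h2 h3
        change max ((s • V + t • W : Lp ℝ ∞ P) ω - a) 0 ≤ _
        rw [h1, Pi.add_apply, h2, h3, Pi.smul_apply, Pi.smul_apply, smul_eq_mul, smul_eq_mul]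
        have e1 := mul_le_mul_of_nonneg_left (le_max_left (V ω - a) 0) hs
        have e2 := mul_le_mul_of_nonneg_left (le_max_left (W ω - a) 0) ht
        refine max_le ?_ (add_nonneg (mul_nonneg hs (le_max_right _ _))
          (mul_nonneg ht (le_max_right _ _)))
        have e3 : a = s * a + t * a := by rw [← add_mul, hst, one_mul]
        linarith
    _ = s * excess a V + t * excess a W := by
        rw [integral_add ((integrable_excess a V).const_mul s)
          ((integrable_excess a W).const_mul t), integral_const_mul, integral_const_mul]
        rfl
    _ ≤ s * ε + t * ε := add_le_add (mul_le_mul_of_nonneg_left hV hs)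
        (mul_le_mul_of_nonneg_left hW ht)
    _ = ε := by rw [← add_mul, hst, one_mul]

theorem tendsto_excess {W : ℕ → Lp ℝ ∞ P} {V : Lp ℝ ∞ P} {C : ℝ} (hC : ∀ n, ‖W n‖ ≤ C)
    (h : ∀ᵐ ω ∂P, Tendsto (fun n => W n ω) atTop (𝓝 (V ω))) (a : ℝ) :
    Tendsto (fun n => excess a (W n)) atTop (𝓝 (excess a V)) := by
  refine tendsto_integral_of_dominated_convergence (fun _ => C + |a|)
    (fun n => (integrable_excess a (W n)).aestronglyMeasurable) (integrable_const _)
    (fun n => ?_) ?_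
  · filter_upwards [ae_abs_le_norm (W n)] with ω hω
    rw [Real.norm_of_nonneg (le_max_right _ _)]
    have h1 := (le_abs_self _).trans (hω.trans (hC n))
    have h2 := (abs_nonneg _).trans (hω.trans (hC n))
    exact max_le (by linarith [neg_abs_le a]) (by positivity)
  · filter_upwards [h] with ω hω
    exact (hω.sub_const a).max tendsto_const_nhds

theorem le_const_of_excess_le_zero {a : ℝ} {W : Lp ℝ ∞ P} (h : excess a W ≤ 0) :
    W ≤ Lp.const ∞ P a := by
  have h0 : excess a W = 0 := le_antisymm h (integral_nonneg fun ω => le_max_right _ _)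
  rw [← Lp.coeFn_le]
  have := (integral_eq_zero_iff_of_nonneg (fun ω => le_max_right _ _) (integrable_excess a W)).1 h0
  filter_upwards [this, Lp.coeFn_const ∞ P a] with ω h1 h2
  rw [h2]
  have h3 : max (W ω - a) 0 = 0 := h1
  simpa using max_eq_right_iff.1 h3

theorem excess_smul_eventInd_le {A : Set Ω} (hA : MeasurableSet A) {r a : ℝ} (hr : 0 < r)
    (ha : 0 ≤ a) : excess a (r • eventInd P hA) ≤ if a < r then r * P.real A else 0 := by
  have h : ∀ᵐ ω ∂P, (r • eventInd P hA : Lp ℝ ∞ P) ω = A.indicator (fun _ => r) ω := by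
    filter_upwards [Lp.coeFn_smul r (eventInd P hA), coeFn_eventInd (P := P) hA] with ω h1 h2
    rw [h1, Pi.smul_apply, h2]
    by_cases hω : ω ∈ A <;> simp [hω]
  split_ifs with har
  · rw [mul_comm, ← smul_eq_mul, ← integral_indicator_const r hA]
    refine integral_mono_ae (integrable_excess a _)
      ((integrable_indicator_iff hA).2 (integrable_const r).integrableOn) ?_
    filter_upwards [h] with ω hω
    change max ((r • eventInd P hA : Lp ℝ ∞ P) ω - a) 0 ≤ _
    rw [hω]
    by_cases hA : ω ∈ A
    · simp only [hA, Set.indicator_of_mem]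
      exact max_le (by linarith) hr.le
    · simp only [hA, Set.indicator_of_notMem, not_false_eq_true]
      exact max_le (by linarith) le_rfl
  · refine (integral_nonpos_of_ae ?_)
    filter_upwards [h] with ω hω
    change max ((r • eventInd P hA : Lp ℝ ∞ P) ω - a) 0 ≤ 0
    rw [hω]
    by_cases hA : ω ∈ A
    · simp only [hA, Set.indicator_of_mem]
      exact max_le (by linarith) le_rfl
    · simp only [hA, Set.indicator_of_notMem, not_false_eq_true]
      exact max_le (by linarith) le_rfl

/-! ### Separation under the Fatou property -/

/-- The Fatou property along bounded almost surely convergent sequences, in terms of the lower level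
sets of `φ`. -/
def AEFatou (φ : Lp ℝ ∞ P → ℝ) : Prop :=
  ∀ (U : ℕ → Lp ℝ ∞ P) (V : Lp ℝ ∞ P) (C m : ℝ), (∀ n, ‖U n‖ ≤ C) →
    (∀ᵐ ω ∂P, Tendsto (fun n => U n ω) atTop (𝓝 (V ω))) → (∀ n, φ (U n) ≤ m) → φ V ≤ m

/-- No loss `W` with `0 ≤ W ≤ δ + k` and expected excesses over `δ, …, δ + (k - 1)` at most
`ε 0, …, ε (k - 1)` brings `φ (U₀ - W)` down to `m`. -/
def ExcessBarrier (φ : Lp ℝ ∞ P → ℝ) (U₀ : Lp ℝ ∞ P) (m δ : ℝ) (k : ℕ) (ε : ℕ → ℝ) : Prop :=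
  ∀ W : Lp ℝ ∞ P, φ (U₀ - W) ≤ m → 0 ≤ W → W ≤ Lp.const ∞ P (δ + k) →
    (∀ j < k, excess (δ + j) W ≤ ε j) → False

theorem norm_le_of_nonneg_of_le_const {W : Lp ℝ ∞ P} {c : ℝ} (h0 : 0 ≤ W)
    (h1 : W ≤ Lp.const ∞ P c) (hc : 0 ≤ c) : ‖W‖ ≤ c := by
  rw [norm_le_iff_ae _ hc]
  filter_upwards [(Lp.coeFn_nonneg W).2 h0, (Lp.coeFn_le _ _).2 h1, Lp.coeFn_const ∞ P c]
    with ω h1 h2 h3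
  rw [h3] at h2
  rw [abs_of_nonneg h1]
  exact h2

theorem convex_setOf_const_bounds (c : ℝ) :
    Convex ℝ {W : Lp ℝ ∞ P | 0 ≤ W ∧ W ≤ Lp.const ∞ P c} := by
  rintro V ⟨hV, hV'⟩ W ⟨hW, hW'⟩ s t hs ht hst
  rw [Set.mem_ofPred_eq, ← Lp.coeFn_nonneg, ← Lp.coeFn_le]
  rw [← Lp.coeFn_nonneg] at hV hW
  rw [← Lp.coeFn_le] at hV' hW'
  constructor
  · filter_upwards [Lp.coeFn_add (s • V) (t • W), Lp.coeFn_smul s V, Lp.coeFn_smul t W, hV, hW]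
      with ω h1 h2 h3 h4 h5
    rw [h1, Pi.add_apply, h2, h3]
    exact add_nonneg (mul_nonneg hs h4) (mul_nonneg ht h5)
  · filter_upwards [Lp.coeFn_add (s • V) (t • W), Lp.coeFn_smul s V, Lp.coeFn_smul t W, hV', hW',
      Lp.coeFn_const ∞ P c] with ω h1 h2 h3 h4 h5 h6
    rw [h6] at h4 h5 ⊢
    rw [h1, Pi.add_apply, h2, h3]
    exact (convex_Iic c) h4 h5 hs ht hst

theorem IsConvexMonetary.convex_setOf_sub_le (hφ : IsConvexMonetary φ) (U₀ : Lp ℝ ∞ P) (m : ℝ) :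
    Convex ℝ {W | φ (U₀ - W) ≤ m} := by
  intro V hV W hW s t hs ht hst
  have h := hφ.convex.2 (Set.mem_univ (U₀ - V)) (Set.mem_univ (U₀ - W)) hs ht hst
  have e : U₀ - (s • V + t • W) = s • (U₀ - V) + t • (U₀ - W) := by
    calc U₀ - (s • V + t • W) = (s + t) • U₀ - (s • V + t • W) := by rw [hst, one_smul]
      _ = _ := by module
  rw [Set.mem_ofPred_eq, e]
  exact h.trans ((convex_Iic m) hV hW hs ht hst)

/-- A further level can be added to the barrier. Otherwise the losses violating it with tolerance
`1 / (n + 1)` at level `δ + k` form decreasing nonempty convex sets; an almost sure limit of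
elements of these sets is at most `δ + k`, against the barrier up to `k`. -/
theorem ExcessBarrier.exists_succ (hφ : IsConvexMonetary φ) (hF : AEFatou φ) {U₀ : Lp ℝ ∞ P}
    {m δ : ℝ} (hδ : 0 ≤ δ) {k : ℕ} {ε : ℕ → ℝ} (h : ExcessBarrier φ U₀ m δ k ε) :
    ∃ e > 0, ExcessBarrier φ U₀ m δ (k + 1) (Function.update ε k e) := by
  by_contra! hcon
  let K : ℕ → Set (Lp ℝ ∞ P) := fun n => {W | φ (U₀ - W) ≤ m} ∩
    ({W | 0 ≤ W ∧ W ≤ Lp.const ∞ P (δ + (k + 1 : ℕ))} ∩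
    ((⋂ j, ⋂ (_ : j < k), {W | excess (δ + j) W ≤ ε j}) ∩
      {W | excess (δ + k) W ≤ 1 / ((n : ℝ) + 1)}))
  have hc : 0 ≤ δ + ((k + 1 : ℕ) : ℝ) := by positivity
  have hbound : ∀ n, ∀ W ∈ K n, ‖W‖ ≤ δ + (k + 1 : ℕ) := fun n W hW =>
    norm_le_of_nonneg_of_le_const hW.2.1.1 hW.2.1.2 hc
  obtain ⟨W, V, hW, hlim⟩ := exists_mem_ae_tendsto_of_antitone (K := K)
    (fun i j hij W hW => ⟨hW.1, hW.2.1, hW.2.2.1,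
      le_trans (Set.mem_ofPred_eq ▸ hW.2.2.2) (Nat.one_div_le_one_div hij)⟩)
    (fun n => (hφ.convex_setOf_sub_le U₀ m).inter ((convex_setOf_const_bounds _).inter
      ((convex_iInter fun j => convex_iInter fun _ => convex_setOf_excess_le _ _).inter
        (convex_setOf_excess_le _ _))))
    (fun n => by
      have hn := hcon (1 / ((n : ℝ) + 1)) Nat.one_div_pos_of_nat
      simp only [ExcessBarrier, not_forall] at hn
      obtain ⟨W, h1, h2, h3, h4, -⟩ := hn
      refine ⟨W, h1, ⟨h2, h3⟩, ?_, ?_⟩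
      · simp only [Set.mem_iInter]
        intro j hj
        have := h4 j (by omega)
        rwa [Function.update_of_ne hj.ne] at this
      · have := h4 k (by omega)
        rwa [Function.update_self] at this)
    hbound
  have hWb : ∀ n, ‖W n‖ ≤ δ + (k + 1 : ℕ) := fun n => hbound n _ (hW n)
  refine h V ?_ ?_ ?_ ?_
  · refine hF (fun n => U₀ - W n) (U₀ - V) (‖U₀‖ + (δ + (k + 1 : ℕ))) m
      (fun n => (norm_sub_le _ _).trans (add_le_add_right (hWb n) _)) ?_ fun n => (hW n).1
    filter_upwards [hlim, Lp.coeFn_sub U₀ V, ae_all_iff.2 fun n => Lp.coeFn_sub U₀ (W n)]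
      with ω h1 h2 h3
    simp_rw [h3, h2, Pi.sub_apply]
    exact h1.const_sub _
  · rw [← Lp.coeFn_nonneg]
    filter_upwards [hlim, ae_all_iff.2 fun n => (Lp.coeFn_nonneg (W n)).2 (hW n).2.1.1]
      with ω h1 h2
    exact ge_of_tendsto' h1 h2
  · refine le_const_of_excess_le_zero ?_
    exact le_of_tendsto_of_tendsto' (tendsto_excess hWb hlim (δ + k))
      tendsto_one_div_add_atTop_nhds_zero_nat fun n => (hW n).2.2.2
  · intro j hj
    refine le_of_tendsto' (tendsto_excess hWb hlim (δ + j)) fun n => ?_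
    have := (hW n).2.2.1
    simp only [Set.mem_iInter] at this
    exact this j hj

theorem excessBarrier_zero (hφ : IsConvexMonetary φ) {U₀ : Lp ℝ ∞ P} {m δ : ℝ}
    (hm : m + δ < φ U₀) (ε : ℕ → ℝ) : ExcessBarrier φ U₀ m δ 0 ε := by
  intro W h1 _ h3 _
  rw [Nat.cast_zero, add_zero] at h3
  have : φ U₀ ≤ φ (U₀ - W) + δ := by
    rw [← hφ.add_const]
    refine hφ.mono ?_
    rw [sub_add_eq_add_sub, add_sub_assoc]
    exact le_add_of_nonneg_right (sub_nonneg.2 h3)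
  linarith

/-- Adding the levels one after the other yields a barrier against all bounded losses. -/
theorem exists_excess_bounds (hφ : IsConvexMonetary φ) (hF : AEFatou φ) {U₀ : Lp ℝ ∞ P}
    {m δ : ℝ} (hδ : 0 < δ) (hm : m + δ < φ U₀) :
    ∃ ε : ℕ → ℝ, (∀ j, 0 < ε j) ∧
      ∀ W : Lp ℝ ∞ P, (∀ j : ℕ, excess (δ + j) W ≤ ε j) → m < φ (U₀ - W) := by
  have hstep : ∀ (k : ℕ) (ε : ℕ → ℝ), ∃ e > 0, ExcessBarrier φ U₀ m δ k ε →
      ExcessBarrier φ U₀ m δ (k + 1) (Function.update ε k e) := by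
    intro k ε
    by_cases h : ExcessBarrier φ U₀ m δ k ε
    · obtain ⟨e, he, h'⟩ := h.exists_succ hφ hF hδ.le
      exact ⟨e, he, fun _ => h'⟩
    · exact ⟨1, one_pos, fun h' => absurd h' h⟩
  choose F hF0 hF1 using hstep
  let s : ℕ → ℕ → ℝ := fun k => Nat.rec (fun _ => 1) (fun k e => Function.update e k (F k e)) k
  have hs : ∀ k, s (k + 1) = Function.update (s k) k (F k (s k)) := fun k => rfl
  have hgood : ∀ k, ExcessBarrier φ U₀ m δ k (s k) := by
    intro k
    induction k with
    | zero => exact excessBarrier_zero hφ hm _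
    | succ k ih => exact hs k ▸ hF1 k (s k) ih
  have hagree : ∀ k, ∀ j < k, s k j = F j (s j) := by
    intro k
    induction k with
    | zero => intro j hj; omega
    | succ k ih =>
      intro j hj
      rw [hs]
      rcases Nat.lt_succ_iff_lt_or_eq.1 hj with h | rfl
      · rw [Function.update_of_ne h.ne, ih j h]
      · rw [Function.update_self]
  refine ⟨fun j => F j (s j), fun j => hF0 j _, fun W hW => ?_⟩
  by_contra! hle
  -- the positive part of `W` has the same excesses and makes `φ (U₀ - W)` smaller
  obtain ⟨k, hk⟩ := exists_nat_ge ‖W ⊔ 0‖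
  refine hgood k (W ⊔ 0) ((hφ.mono (sub_le_sub_left le_sup_left U₀)).trans hle) le_sup_right
    (le_const_of_norm_le _ (by linarith)) fun j hj => ?_
  rw [hagree k j hj]
  refine le_trans (le_of_eq (integral_congr_ae ?_)) (hW j)
  filter_upwards [Lp.coeFn_sup W 0, Lp.coeFn_zero ℝ ∞ P] with ω h1 h2
  have hj0 : 0 ≤ δ + (j : ℝ) := by positivity
  rw [h1, Pi.sup_apply, h2, Pi.zero_apply]
  rcases le_total (W ω) 0 with h | h
  · rw [sup_eq_right.2 h, max_eq_right (by linarith), max_eq_right (by linarith)]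
  · rw [sup_eq_left.2 h]

theorem tendsto_measureReal_of_antitone {A : ℕ → Set Ω} (hA : ∀ n, MeasurableSet (A n))
    (hanti : Antitone A) (hinter : ⋂ n, A n = ∅) :
    Tendsto (fun n => P.real (A n)) atTop (𝓝 0) := by
  have h := tendsto_measure_iInter_atTop (μ := P) (fun n => (hA n).nullMeasurableSet) hanti
    ⟨0, measure_ne_top P _⟩
  rw [hinter, measure_empty] at h
  exact (ENNReal.tendsto_toReal ENNReal.zero_ne_top).comp h

/-- Under the Fatou property, `φ U₀` is approximated from below by dual values. The set `G` of the
losses satisfying the excess bounds contains a neighbourhood of `0` and of `r • 1_{A n}` for large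
`n` whenever `A n` decreases to `∅`, so that a functional separating `G` from the disjoint convex
set `{W | φ (U₀ - W) ≤ m}` is countably additive. -/
theorem exists_absContProb_of_lt (hφ : IsConvexMonetary φ) (hF : AEFatou φ) {U₀ : Lp ℝ ∞ P}
    {m : ℝ} (hm : m < φ U₀) :
    ∃ Q : AbsContProb P, ∀ V, φ V ≤ 0 → expectation Q V + m ≤ expectation Q U₀ := by
  obtain ⟨δ, hδ, hmδ⟩ : ∃ δ > 0, m + δ < φ U₀ := ⟨(φ U₀ - m) / 2, by linarith, by linarith⟩
  obtain ⟨ε, hε, hbar⟩ := exists_excess_bounds hφ hF hδ hmδ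
  set G : Set (Lp ℝ ∞ P) := ⋂ j : ℕ, {W | excess (δ + j) W ≤ ε j} with hG
  have hGconv : Convex ℝ G := convex_iInter fun j => convex_setOf_excess_le _ _
  have hint : ∀ Z : Lp ℝ ∞ P, (∀ j : ℕ, excess j Z ≤ ε j) → Z ∈ interior G := by
    intro Z hZ
    rw [mem_interior_iff_mem_nhds]
    refine mem_of_superset (Metric.ball_mem_nhds Z hδ) fun W hW => ?_
    rw [mem_ball_iff_norm] at hW
    rw [hG, Set.mem_iInter]
    intro j
    refine (excess_mono ?_).trans (hZ j)
    filter_upwards [(norm_le_iff_ae (W - Z) hδ.le).1 hW.le, Lp.coeFn_sub W Z] with ω h1 h2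
    rw [h2, Pi.sub_apply] at h1
    linarith [(abs_le.1 h1).2]
  have h0G : (0 : Lp ℝ ∞ P) ∈ interior G := hint 0 fun j => by
    rw [excess_zero j.cast_nonneg]
    exact (hε j).le
  have hdisj : Disjoint (interior G) {W | φ (U₀ - W) ≤ m} := by
    refine Set.disjoint_left.2 fun W hW hW' => ?_
    have := hbar W fun j => Set.mem_iInter.1 (interior_subset hW) j
    exact absurd hW' (not_le.2 this)
  obtain ⟨f, u, hfu, huf⟩ := geometric_hahn_banach_open hGconv.interior isOpen_interior
    (hφ.convex_setOf_sub_le U₀ m) hdisj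
  have hu : 0 < u := by simpa using hfu 0 h0G
  set b := U₀ - Lp.const ∞ P m with hb
  have hbm : φ (U₀ - b) ≤ m := by rw [hb, sub_sub_cancel, hφ.map_const]
  have hpos : ∀ Z, 0 ≤ Z → 0 ≤ f Z := by
    intro Z hZ
    refine nonneg_of_forall_nat_mul_le (b := u - f b) fun n => ?_
    have h1 : φ (U₀ - (b + (n : ℝ) • Z)) ≤ m := by
      refine (hφ.mono (sub_le_sub_left (le_add_of_nonneg_right ?_) U₀)).trans hbm
      rw [Nat.cast_smul_eq_nsmul]
      exact nsmul_nonneg hZ n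
    have h2 := huf _ h1
    rw [map_add, map_smul, smul_eq_mul] at h2
    linarith
  have h1 : 0 < f (Lp.const ∞ P (1 : ℝ)) := apply_const_one_pos hpos (hu.trans_le (huf b hbm))
  obtain ⟨Q, hQ⟩ := exists_absContProb_of_eventually_le hpos h1 u (by
    intro A hA hanti hinter r hr
    -- only the finitely many levels below `r` constrain `r • 1_{A n}`
    have hfin : ∀ᶠ n in atTop, ∀ j ∈ Finset.range ⌈r⌉₊, r * P.real (A n) < ε j := by
      rw [Filter.eventually_all_finset]
      intro j _
      have := (tendsto_measureReal_of_antitone (P := P) hA hanti hinter).const_mul r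
      rw [mul_zero] at this
      exact this.eventually_lt_const (hε j)
    filter_upwards [hfin] with n hn
    refine (hfu _ (hint _ fun j => ?_)).le
    refine (excess_smul_eventInd_le (hA n) hr j.cast_nonneg).trans ?_
    split_ifs with hj
    · exact (hn j (Finset.mem_range.2 (Nat.lt_ceil.2 hj))).le
    · exact (hε j).le)
  refine ⟨Q, fun V hV => ?_⟩
  have h2 : φ (U₀ - (U₀ - (V + Lp.const ∞ P m))) ≤ m := by
    rw [sub_sub_cancel, hφ.add_const]
    linarith
  have h3 := huf _ h2
  rw [map_sub, map_add, const_eq_smul, map_smul, smul_eq_mul, hQ V, hQ U₀] at h3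
  have h4 : f (Lp.const ∞ P (1 : ℝ)) * (expectation Q V + m) ≤
      f (Lp.const ∞ P (1 : ℝ)) * expectation Q U₀ := by linarith
  exact le_of_mul_le_mul_left h4 h1

end

section

/-! ### The logarithmic transform of a return risk measure -/

theorem LInfPP.ext {X Y : LInfPP P} (h : X =ᵐ[P] Y) : X = Y := Subtype.ext (Lp.ext h)

/-- `exp U ∈ L^∞_{++}`, for `U ∈ L^∞`. -/
noncomputable def expRV (U : Lp ℝ ∞ P) : LInfPP P :=
  LInfPP.ofFun (fun ω => Real.exp (U ω))
    (Real.continuous_exp.comp_aestronglyMeasurable (Lp.aestronglyMeasurable U))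
    ⟨Real.exp (-‖U‖), Real.exp ‖U‖, Real.exp_pos _, by
      filter_upwards [ae_abs_le_norm U] with ω h
      exact ⟨Real.exp_le_exp.2 (abs_le.1 h).1, Real.exp_le_exp.2 (abs_le.1 h).2⟩⟩

theorem coeFn_expRV (U : Lp ℝ ∞ P) : expRV U =ᵐ[P] fun ω => Real.exp (U ω) :=
  LInfPP.coeFn_ofFun _ _ _

theorem memLp_log (X : LInfPP P) : MemLp (fun ω => Real.log (X ω)) ∞ P := by
  obtain ⟨c, C, hc, hC, h⟩ := X.exists_bounds
  refine memLp_top_of_bound X.aestronglyMeasurable.aemeasurable.log.aestronglyMeasurable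
    (max |Real.log c| |Real.log C|) ?_
  filter_upwards [h] with ω hω
  exact abs_le_max_abs_abs (Real.log_le_log hc hω.1)
    (Real.log_le_log (hc.trans_le hω.1) hω.2)

/-- `log X ∈ L^∞`, for `X ∈ L^∞_{++}`. -/
noncomputable def logRV (X : LInfPP P) : Lp ℝ ∞ P := (memLp_log X).toLp _

theorem coeFn_logRV (X : LInfPP P) : logRV X =ᵐ[P] fun ω => Real.log (X ω) :=
  (memLp_log X).coeFn_toLp

theorem LInfPP.ae_pos (X : LInfPP P) : ∀ᵐ ω ∂P, 0 < X ω := by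
  obtain ⟨c, hc, h⟩ := X.2
  filter_upwards [h] with ω hω
  exact hc.trans_le hω

theorem expRV_logRV (X : LInfPP P) : expRV (logRV X) = X := by
  refine LInfPP.ext ?_
  filter_upwards [coeFn_expRV (logRV X), coeFn_logRV X, X.ae_pos] with ω h1 h2 h3
  rw [h1, h2, Real.exp_log h3]

theorem logRV_expRV (U : Lp ℝ ∞ P) : logRV (expRV U) = U := by
  refine Lp.ext ?_
  filter_upwards [coeFn_expRV U, coeFn_logRV (expRV U)] with ω h1 h2
  rw [h2, h1, Real.log_exp]

theorem expMeanLog_eq (Q : AbsContProb P) (X : LInfPP P) :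
    expMeanLog Q X = ENNReal.ofReal (Real.exp (expectation Q (logRV X))) := by
  rw [expMeanLog, expectation_apply, integral_congr_ae (Q.2.ae_le (coeFn_logRV X))]

variable {ρ : LInfPP P → ℝ}

/-- `U ↦ log ρ(exp U)`. -/
noncomputable def logRisk (ρ : LInfPP P → ℝ) (U : Lp ℝ ∞ P) : ℝ := Real.log (ρ (expRV U))

theorem logRisk_logRV (X : LInfPP P) : logRisk ρ (logRV X) = Real.log (ρ X) := by
  rw [logRisk, expRV_logRV]

/-- A lower dual bound for `logRisk ρ` is one for `ρ`. -/
theorem ofReal_exp_le_alpha_mul (hρ : IsReturnRiskMeasure ρ) {Q : AbsContProb P} {X : LInfPP P}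
    {m : ℝ} (h : ∀ V, logRisk ρ V ≤ 0 → expectation Q V + m ≤ expectation Q (logRV X)) :
    ENNReal.ofReal (Real.exp m) ≤ alpha ρ Q * expMeanLog Q X := by
  have hsup : ⨆ Y ∈ acceptanceSet ρ, expMeanLog Q Y ≤
      ENNReal.ofReal (Real.exp (expectation Q (logRV X) - m)) := by
    refine iSup₂_le fun Y hY => ?_
    rw [expMeanLog_eq]
    refine ENNReal.ofReal_le_ofReal (Real.exp_le_exp.2 ?_)
    have h0 : logRisk ρ (logRV Y) ≤ 0 := by
      rw [logRisk_logRV]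
      exact Real.log_nonpos (hρ.pos Y).le hY
    linarith [h _ h0]
  calc ENNReal.ofReal (Real.exp m)
      = (ENNReal.ofReal (Real.exp (expectation Q (logRV X) - m)))⁻¹ * expMeanLog Q X := by
        rw [expMeanLog_eq, ← ENNReal.ofReal_inv_of_pos (Real.exp_pos _), ← Real.exp_neg,
          ← ENNReal.ofReal_mul (Real.exp_pos _).le, ← Real.exp_add]
        congr 2
        ring
    _ ≤ alpha ρ Q * expMeanLog Q X := mul_le_mul_left (ENNReal.inv_le_inv.2 hsup) _

variable [IsProbabilityMeasure P]

/-- Positive homogeneity of `ρ` becomes cash additivity and geometric convexity becomes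
convexity. -/
theorem isConvexMonetary_logRisk (hρ : IsReturnRiskMeasure ρ) (hconv : IsGGConvex ρ) :
    IsConvexMonetary (logRisk ρ) where
  mono := by
    intro U V h
    refine Real.log_le_log (hρ.pos _) (hρ.mono _ _ ?_)
    filter_upwards [coeFn_expRV U, coeFn_expRV V, (Lp.coeFn_le U V).2 h] with ω h1 h2 h3
    rw [h1, h2]
    exact Real.exp_le_exp.2 h3
  add_const := by
    intro U c
    have h : expRV (U + Lp.const ∞ P c) = LInfPP.scale (Real.exp c) (Real.exp_pos c) (expRV U) := by
      refine LInfPP.ext (EventuallyEq.trans ?_ (LInfPP.coeFn_ofFun _ _ _).symm)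
      filter_upwards [coeFn_expRV (U + Lp.const ∞ P c), coeFn_expRV U,
        Lp.coeFn_add U (Lp.const ∞ P c), Lp.coeFn_const ∞ P c] with ω h1 h2 h3 h4
      rw [h1, h2, h3, Pi.add_apply, h4, Function.const_apply, Real.exp_add, mul_comm]
    rw [logRisk, h, hρ.pos_hom, Real.log_mul (Real.exp_pos c).ne' (hρ.pos _).ne', Real.log_exp,
      add_comm, logRisk]
  convex := by
    refine convexOn_iff_forall_pos.2 ⟨convex_univ, fun U _ V _ s t hs ht hst => ?_⟩
    have hs1 : s ∈ Set.Ioo (0 : ℝ) 1 := ⟨hs, by linarith⟩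
    obtain rfl : t = 1 - s := by linarith
    have h : expRV (s • U + (1 - s) • V) = LInfPP.geomMean s hs1 (expRV U) (expRV V) := by
      refine LInfPP.ext (EventuallyEq.trans ?_ (LInfPP.coeFn_ofFun _ _ _).symm)
      filter_upwards [coeFn_expRV (s • U + (1 - s) • V), coeFn_expRV U, coeFn_expRV V,
        Lp.coeFn_add (s • U) ((1 - s) • V), Lp.coeFn_smul s U, Lp.coeFn_smul (1 - s) V]
        with ω h1 h2 h3 h4 h5 h6
      rw [h1, h2, h3, h4, Pi.add_apply, h5, h6, Pi.smul_apply, Pi.smul_apply, smul_eq_mul,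
        smul_eq_mul, ← Real.exp_mul, ← Real.exp_mul, ← Real.exp_add]
      ring_nf
    have hU := hρ.pos (expRV U)
    have hV := hρ.pos (expRV V)
    calc logRisk ρ (s • U + (1 - s) • V)
        ≤ Real.log (ρ (expRV U) ^ s * ρ (expRV V) ^ (1 - s)) := by
          rw [logRisk, h]
          exact Real.log_le_log (hρ.pos _) (hconv _ _ s hs1)
      _ = s • logRisk ρ U + (1 - s) • logRisk ρ V := by
          rw [Real.log_mul (Real.rpow_pos_of_pos hU _).ne' (Real.rpow_pos_of_pos hV _).ne',
            Real.log_rpow hU, Real.log_rpow hV]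
          rfl
  map_zero := by
    have h : expRV (0 : Lp ℝ ∞ P) = LInfPP.one := by
      refine LInfPP.ext (EventuallyEq.trans ?_ (LInfPP.coeFn_ofFun _ _ _).symm)
      filter_upwards [coeFn_expRV (0 : Lp ℝ ∞ P), Lp.coeFn_zero ℝ ∞ P] with ω h1 h2
      rw [h1, h2, Pi.zero_apply, Real.exp_zero]
    rw [logRisk, h, hρ.map_one, Real.log_one]

theorem lowerBoundedConv_expRV {U : ℕ → Lp ℝ ∞ P} {V : Lp ℝ ∞ P} {C : ℝ} (hC : ∀ n, ‖U n‖ ≤ C)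
    (h : ∀ᵐ ω ∂P, Tendsto (fun n => U n ω) atTop (𝓝 (V ω))) :
    LowerBoundedConv (fun n => expRV (U n)) (expRV V) := by
  refine ⟨tendstoInMeasure_of_tendsto_ae (fun n => (expRV (U n)).aestronglyMeasurable) ?_,
    ⟨Real.exp C, fun n => ?_⟩, ⟨Real.exp (-C), Real.exp_pos _, fun n => ?_⟩⟩
  · filter_upwards [h, coeFn_expRV V, ae_all_iff.2 fun n => coeFn_expRV (U n)] with ω h1 h2 h3
    simp_rw [h2, h3]
    exact (Real.continuous_exp.tendsto _).comp h1
  · rw [norm_le_iff_ae _ (Real.exp_pos C).le]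
    filter_upwards [coeFn_expRV (U n), ae_abs_le_norm (U n)] with ω h1 h2
    rw [h1, Real.abs_exp]
    exact Real.exp_le_exp.2 ((le_abs_self _).trans (h2.trans (hC n)))
  · filter_upwards [coeFn_expRV (U n), ae_abs_le_norm (U n)] with ω h1 h2
    rw [h1]
    exact Real.exp_le_exp.2 (abs_le.1 (h2.trans (hC n))).1

theorem aeFatou_logRisk (hρ : IsReturnRiskMeasure ρ) (hfatou : LowerBoundedFatou ρ) :
    AEFatou (logRisk ρ) := by
  intro U V C m hC h hm
  have hle : ∀ n, ρ (expRV (U n)) ≤ Real.exp m := fun n =>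
    (Real.log_le_iff_le_exp (hρ.pos _)).1 (hm n)
  refine (Real.log_le_iff_le_exp (hρ.pos _)).2 (EReal.coe_le_coe_iff.1 ?_)
  calc ((ρ (expRV V) : ℝ) : EReal)
      ≤ liminf (fun n => ((ρ (expRV (U n)) : ℝ) : EReal)) atTop :=
        hfatou _ _ (lowerBoundedConv_expRV hC h)
    _ ≤ liminf (fun _ : ℕ => ((Real.exp m : ℝ) : EReal)) atTop :=
        liminf_le_liminf (Eventually.of_forall fun n => EReal.coe_le_coe_iff.2 (hle n))
    _ = ((Real.exp m : ℝ) : EReal) := liminf_const _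

theorem tendsto_logRisk (hρ : IsReturnRiskMeasure ρ) (hL : LowerBoundedLebesgue ρ)
    {U : ℕ → Lp ℝ ∞ P} {V : Lp ℝ ∞ P} {C : ℝ} (hC : ∀ n, ‖U n‖ ≤ C)
    (h : ∀ᵐ ω ∂P, Tendsto (fun n => U n ω) atTop (𝓝 (V ω))) :
    Tendsto (fun n => logRisk ρ (U n)) atTop (𝓝 (logRisk ρ V)) :=
  (hL _ _ (lowerBoundedConv_expRV hC h)).log (hρ.pos _).ne'

/-! ### The dual representation -/

theorem alpha_le_one (hρ : IsReturnRiskMeasure ρ) (Q : AbsContProb P) : alpha ρ Q ≤ 1 := by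
  rw [alpha, ENNReal.inv_le_one]
  refine le_trans (le_of_eq ?_) (le_iSup₂ (f := fun X (_ : X ∈ acceptanceSet ρ) => expMeanLog Q X)
    LInfPP.one hρ.map_one.le)
  have h : logRV (LInfPP.one : LInfPP P) = Lp.const ∞ P (0 : ℝ) := by
    refine Lp.ext ?_
    filter_upwards [coeFn_logRV (LInfPP.one : LInfPP P), Lp.coeFn_const ∞ P (0 : ℝ),
      LInfPP.coeFn_ofFun (P := P) (fun _ => 1) aestronglyMeasurable_const
        ⟨1, 1, one_pos, Eventually.of_forall fun _ => ⟨le_rfl, le_rfl⟩⟩] with ω h1 h2 h3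
    rw [h1, h2, LInfPP.one, h3, Real.log_one, Function.const_apply]
  rw [expMeanLog_eq, h, expectation_const, Real.exp_zero, ENNReal.ofReal_one]

/-- The upper bound holds because `X / ρ(X)` is acceptable. -/
theorem alpha_mul_expMeanLog_le (hρ : IsReturnRiskMeasure ρ) (Q : AbsContProb P) (X : LInfPP P) :
    alpha ρ Q * expMeanLog Q X ≤ ENNReal.ofReal (ρ X) := by
  have hX := hρ.pos X
  -- `Y = X / ρ(X)`
  set Y := LInfPP.scale (ρ X)⁻¹ (inv_pos.2 hX) X with hY
  have hYB : Y ∈ acceptanceSet ρ := by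
    change ρ Y ≤ 1
    rw [hY, hρ.pos_hom, inv_mul_cancel₀ hX.ne']
  have hlog : logRV X = logRV Y + Lp.const ∞ P (Real.log (ρ X)) := by
    refine Lp.ext ?_
    filter_upwards [coeFn_logRV X, coeFn_logRV Y,
      Lp.coeFn_add (logRV Y) (Lp.const ∞ P (Real.log (ρ X))), Lp.coeFn_const ∞ P (Real.log (ρ X)),
      show Y =ᵐ[P] fun ω => (ρ X)⁻¹ * X ω from LInfPP.coeFn_ofFun _ _ _, X.ae_pos]
      with ω h1 h2 h3 h4 h5 h6
    rw [h3, Pi.add_apply, h4, h1, h2, h5, Real.log_mul (inv_pos.2 hX).ne' h6.ne', Real.log_inv,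
      Function.const_apply]
    ring
  have hXY : expMeanLog Q X = expMeanLog Q Y * ENNReal.ofReal (ρ X) := by
    rw [expMeanLog_eq, expMeanLog_eq, hlog, map_add, expectation_const, Real.exp_add,
      Real.exp_log hX, ENNReal.ofReal_mul (Real.exp_pos _).le]
  have hle : expMeanLog Q Y ≤ ⨆ X ∈ acceptanceSet ρ, expMeanLog Q X :=
    le_iSup₂ (f := fun X (_ : X ∈ acceptanceSet ρ) => expMeanLog Q X) Y hYB
  rw [hXY, ← mul_assoc]
  refine mul_le_of_le_one_left (zero_le) ?_
  exact (mul_le_mul_right hle _).trans (ENNReal.inv_mul_le_one _)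

theorem ofReal_eq_iSup_alpha_mul (hρ : IsReturnRiskMeasure ρ) (hconv : IsGGConvex ρ)
    (hfatou : LowerBoundedFatou ρ) (X : LInfPP P) :
    ENNReal.ofReal (ρ X) = ⨆ Q : AbsContProb P, alpha ρ Q * expMeanLog Q X := by
  refine le_antisymm ?_ (iSup_le fun Q => alpha_mul_expMeanLog_le hρ Q X)
  have hm : ∀ m < logRisk ρ (logRV X), ENNReal.ofReal (Real.exp m) ≤
      ⨆ Q : AbsContProb P, alpha ρ Q * expMeanLog Q X := by
    intro m hm
    obtain ⟨Q, hQ⟩ := exists_absContProb_of_lt (isConvexMonetary_logRisk hρ hconv)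
      (aeFatou_logRisk hρ hfatou) hm
    exact (ofReal_exp_le_alpha_mul hρ hQ).trans
      (le_iSup (fun Q : AbsContProb P => alpha ρ Q * expMeanLog Q X) Q)
  have hlim : Tendsto (fun m => ENNReal.ofReal (Real.exp m)) (𝓝[<] logRisk ρ (logRV X))
      (𝓝 (ENNReal.ofReal (ρ X))) := by
    have := ((ENNReal.continuous_ofReal.comp Real.continuous_exp).tendsto
      (logRisk ρ (logRV X))).mono_left (nhdsWithin_le_nhds (s := Set.Iio (logRisk ρ (logRV X))))
    have e : Real.exp (logRisk ρ (logRV X)) = ρ X := by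
      rw [logRisk_logRV, Real.exp_log (hρ.pos X)]
    rwa [Function.comp_apply, e] at this
  refine le_of_tendsto hlim ?_
  filter_upwards [self_mem_nhdsWithin] with m h
  exact hm m h

theorem exists_ofReal_eq_alpha_mul (hρ : IsReturnRiskMeasure ρ) (hconv : IsGGConvex ρ)
    (hL : LowerBoundedLebesgue ρ) (X : LInfPP P) :
    ∃ Q : AbsContProb P, ENNReal.ofReal (ρ X) = alpha ρ Q * expMeanLog Q X := by
  obtain ⟨Q, hQ⟩ := exists_absContProb_supporting (isConvexMonetary_logRisk hρ hconv)
    (fun U V C => tendsto_logRisk hρ hL) (logRV X)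
  refine ⟨Q, le_antisymm ?_ (alpha_mul_expMeanLog_le hρ Q X)⟩
  have := ofReal_exp_le_alpha_mul hρ hQ
  rwa [logRisk_logRV, Real.exp_log (hρ.pos X)] at this

end

section

/-! ### Comonotone pairs and the Hardy–Littlewood inequality -/

section Rearrangement

variable {α β : Type*} [MeasurableSpace α] [MeasurableSpace β] {μ : Measure α} {ν : Measure β}

/-- `f` and `g` are comonotone under `μ`: their strict upper level sets are nested, up to null
sets. -/
def Comonotone (μ : Measure α) (f g : α → ℝ) : Prop :=
  ∀ s t : ℝ, ({a | s < f a} : Set α) ≤ᵐ[μ] {a | t < g a} ∨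
    ({a | t < g a} : Set α) ≤ᵐ[μ] {a | s < f a}

theorem measure_inter_eq_min {A B : Set α} (h : A ≤ᵐ[μ] B ∨ B ≤ᵐ[μ] A) :
    μ (A ∩ B) = min (μ A) (μ B) := by
  rcases h with h | h
  · rw [min_eq_left (measure_mono_ae h)]
    refine measure_congr ?_
    filter_upwards [h] with a ha
    exact propext ⟨fun h => h.1, fun h => ⟨h, ha h⟩⟩
  · rw [min_eq_right (measure_mono_ae h)]
    refine measure_congr ?_
    filter_upwards [h] with a ha
    exact propext ⟨fun h => h.2, fun h => ⟨ha h, h⟩⟩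

/-- The layer cake formula for a product. -/
theorem lintegral_ofReal_mul_ofReal [IsFiniteMeasure μ] {f g : α → ℝ} (hf : AEMeasurable f μ)
    (hg : AEMeasurable g μ) (hf0 : 0 ≤ᵐ[μ] f) (hg0 : 0 ≤ᵐ[μ] g) :
    ∫⁻ a, ENNReal.ofReal (f a) * ENNReal.ofReal (g a) ∂μ =
      ∫⁻ s in Set.Ioi 0, ∫⁻ t in Set.Ioi 0, μ ({a | s < f a} ∩ {a | t < g a}) := by
  have hac := withDensity_absolutelyContinuous μ fun a => ENNReal.ofReal (g a)
  calc ∫⁻ a, ENNReal.ofReal (f a) * ENNReal.ofReal (g a) ∂μ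
      = ∫⁻ a, ENNReal.ofReal (f a) ∂μ.withDensity fun a => ENNReal.ofReal (g a) := by
        rw [lintegral_withDensity_eq_lintegral_mul₀ hg.ennreal_ofReal hf.ennreal_ofReal]
        exact lintegral_congr fun a => mul_comm _ _
    _ = ∫⁻ s in Set.Ioi 0, (μ.withDensity fun a => ENNReal.ofReal (g a)) {a | s < f a} :=
        lintegral_eq_lintegral_meas_lt _ (hac.ae_le hf0) (hf.mono_ac hac)
    _ = _ := by
        refine lintegral_congr fun s => ?_
        rw [withDensity_apply',
          lintegral_eq_lintegral_meas_lt _ (ae_restrict_of_ae hg0) hg.restrict]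
        refine lintegral_congr fun t => ?_
        rw [Measure.restrict_apply₀' (nullMeasurableSet_lt aemeasurable_const hf), Set.inter_comm]

theorem Comonotone.add_const_left {f g : α → ℝ} (h : Comonotone μ f g) (c : ℝ) :
    Comonotone μ (fun a => f a + c) g := by
  intro s t
  simpa only [sub_lt_iff_lt_add] using h (s - c) t

theorem _root_.ProbabilityTheory.IdentDistrib.measure_lt_eq {f : α → ℝ} {f' : β → ℝ}
    (h : IdentDistrib f f' μ ν) (s : ℝ) : μ {a | s < f a} = ν {b | s < f' b} :=
  h.measure_mem_eq (s := Set.Ioi s) measurableSet_Ioi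

theorem lintegral_mul_le_of_comonotone [IsFiniteMeasure μ] [IsFiniteMeasure ν] {f g : α → ℝ}
    {f' g' : β → ℝ} (hf : IdentDistrib f f' μ ν) (hg : IdentDistrib g g' μ ν) (hf0 : 0 ≤ᵐ[μ] f)
    (hg0 : 0 ≤ᵐ[μ] g) (h : Comonotone ν f' g') :
    ∫⁻ a, ENNReal.ofReal (f a) * ENNReal.ofReal (g a) ∂μ ≤
      ∫⁻ b, ENNReal.ofReal (f' b) * ENNReal.ofReal (g' b) ∂ν := by
  rw [lintegral_ofReal_mul_ofReal hf.aemeasurable_fst hg.aemeasurable_fst hf0 hg0,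
    lintegral_ofReal_mul_ofReal hf.aemeasurable_snd hg.aemeasurable_snd
      (hf.ae_snd measurableSet_Ici hf0) (hg.ae_snd measurableSet_Ici hg0)]
  refine lintegral_mono fun s => lintegral_mono fun t => ?_
  rw [measure_inter_eq_min (h s t), ← hf.measure_lt_eq, ← hg.measure_lt_eq]
  exact le_min (measure_mono Set.inter_subset_left) (measure_mono Set.inter_subset_right)

/-- The Hardy–Littlewood inequality: among the pairs with given marginal laws, comonotone pairs have
the largest expected product. -/
theorem integral_mul_le_of_comonotone [IsProbabilityMeasure μ] [IsProbabilityMeasure ν]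
    {f g : α → ℝ} {f' g' : β → ℝ} (hf : IdentDistrib f f' μ ν) (hg : IdentDistrib g g' μ ν)
    {C : ℝ} (hfC : ∀ᵐ a ∂μ, |f a| ≤ C) (hg0 : 0 ≤ᵐ[μ] g) (hgi : Integrable g μ)
    (h : Comonotone ν f' g') : ∫ a, f a * g a ∂μ ≤ ∫ b, f' b * g' b ∂ν := by
  have hfC' : ∀ᵐ b ∂ν, |f' b| ≤ C :=
    hf.ae_snd (measurableSet_le continuous_abs.measurable measurable_const) hfC
  have hg0' : 0 ≤ᵐ[ν] g' := hg.ae_snd measurableSet_Ici hg0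
  have hgi' : Integrable g' ν := hg.integrable_snd hgi
  have hi : Integrable (fun a => f a * g a) μ :=
    hgi.bdd_mul hf.aemeasurable_fst.aestronglyMeasurable hfC
  have hi' : Integrable (fun b => f' b * g' b) ν :=
    hgi'.bdd_mul hf.aemeasurable_snd.aestronglyMeasurable hfC'
  -- the shift by `C` makes the first factors nonnegative
  have e : ∫ a, (f a + C) * g a ∂μ = ∫ a, f a * g a ∂μ + C * ∫ a, g a ∂μ := by
    rw [← integral_const_mul, ← integral_add hi (hgi.const_mul C)]
    simp_rw [add_mul]
  have e' : ∫ b, (f' b + C) * g' b ∂ν = ∫ b, f' b * g' b ∂ν + C * ∫ a, g a ∂μ := by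
    rw [hg.integral_eq, ← integral_const_mul, ← integral_add hi' (hgi'.const_mul C)]
    simp_rw [add_mul]
  have hfs : IdentDistrib (fun a => f a + C) (fun b => f' b + C) μ ν :=
    hf.comp (measurable_id.add_const C)
  have hs0 : ∀ᵐ a ∂μ, 0 ≤ f a + C := by
    filter_upwards [hfC] with a ha
    linarith [(abs_le.1 ha).1]
  have hs0' : ∀ᵐ b ∂ν, 0 ≤ f' b + C := by
    filter_upwards [hfC'] with a ha
    linarith [(abs_le.1 ha).1]
  have hsi : Integrable (fun a => (f a + C) * g a) μ := by
    simp_rw [add_mul]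
    exact hi.add (hgi.const_mul C)
  have hsi' : Integrable (fun b => (f' b + C) * g' b) ν := by
    simp_rw [add_mul]
    exact hi'.add (hgi'.const_mul C)
  have key : ∫ a, (f a + C) * g a ∂μ ≤ ∫ b, (f' b + C) * g' b ∂ν := by
    rw [integral_eq_lintegral_of_nonneg_ae
        (by filter_upwards [hs0, hg0] with a h1 h2 using mul_nonneg h1 h2)
        hsi.aestronglyMeasurable,
      integral_eq_lintegral_of_nonneg_ae
        (by filter_upwards [hs0', hg0'] with a h1 h2 using mul_nonneg h1 h2)
        hsi'.aestronglyMeasurable]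
    refine ENNReal.toReal_mono hsi'.lintegral_lt_top.ne ?_
    rw [lintegral_congr_ae (g := fun a => ENNReal.ofReal (f a + C) * ENNReal.ofReal (g a))
        (by filter_upwards [hs0] with a h1 using ENNReal.ofReal_mul h1),
      lintegral_congr_ae (g := fun b => ENNReal.ofReal (f' b + C) * ENNReal.ofReal (g' b))
        (by filter_upwards [hs0'] with a h1 using ENNReal.ofReal_mul h1)]
    exact lintegral_mul_le_of_comonotone hfs hg hs0 hg0 (h.add_const_left C)
  linarith

theorem identDistrib_of_measure_lt_eq [IsProbabilityMeasure μ] [IsProbabilityMeasure ν]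
    {f : α → ℝ} {f' : β → ℝ} (hf : AEMeasurable f μ) (hf' : AEMeasurable f' ν)
    (h : ∀ s, μ {a | s < f a} = ν {b | s < f' b}) : IdentDistrib f f' μ ν := by
  refine ⟨hf, hf', ?_⟩
  have := Measure.isProbabilityMeasure_map hf
  have := Measure.isProbabilityMeasure_map hf'
  refine Measure.ext_of_Iic _ _ fun s => ?_
  rw [← Set.compl_Ioi, prob_compl_eq_one_sub measurableSet_Ioi,
    prob_compl_eq_one_sub measurableSet_Ioi, Measure.map_apply_of_aemeasurable hf measurableSet_Ioi,
    Measure.map_apply_of_aemeasurable hf' measurableSet_Ioi]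
  exact congrArg _ (h s)

end Rearrangement

/-! ### Quantile functions -/

variable [IsProbabilityMeasure P]

instance : IsProbabilityMeasure (volume.restrict (Set.Ioo (0 : ℝ) 1)) := ⟨by simp⟩

namespace IsQuantileFunction

variable {Z : Ω → ℝ} {q : ℝ → ℝ}

theorem monotoneOn (hq : IsQuantileFunction P Z q) : MonotoneOn q (Set.Ioo (0 : ℝ) 1) := by
  intro s hs t ht hst
  rcases hst.eq_or_lt with rfl | hst
  · exact le_rfl
  by_contra! hlt
  have h1 : P.real {ω | Z ω ≤ q t} ≤ P.real {ω | Z ω < q s} :=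
    measureReal_mono fun ω hω => lt_of_le_of_lt hω hlt
  linarith [(hq s hs).1, (hq t ht).2]

theorem le_of_lt_measureReal (hq : IsQuantileFunction P Z q) {t x : ℝ}
    (ht : t ∈ Set.Ioo (0 : ℝ) 1) (h : t < P.real {ω | Z ω ≤ x}) : q t ≤ x := by
  by_contra! hlt
  have h1 : P.real {ω | Z ω ≤ x} ≤ P.real {ω | Z ω < q t} :=
    measureReal_mono fun ω hω => lt_of_le_of_lt hω hlt
  linarith [(hq t ht).1]

theorem le_measureReal_of_le (hq : IsQuantileFunction P Z q) {t x : ℝ}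
    (ht : t ∈ Set.Ioo (0 : ℝ) 1) (h : q t ≤ x) : t ≤ P.real {ω | Z ω ≤ x} :=
  (hq t ht).2.trans (measureReal_mono fun _ hω => le_trans hω h)

/-- A quantile function of `Z` has, under the Lebesgue measure on `(0, 1)`, the law of `Z`. -/
theorem identDistrib (hq : IsQuantileFunction P Z q) (hZ : AEMeasurable Z P) :
    IdentDistrib Z q P (volume.restrict (Set.Ioo (0 : ℝ) 1)) := by
  refine identDistrib_of_measure_lt_eq hZ
    (aemeasurable_restrict_of_monotoneOn measurableSet_Ioo hq.monotoneOn) fun x => ?_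
  set F := P.real {ω | Z ω ≤ x} with hF
  have hF0 : 0 ≤ F := measureReal_nonneg
  have hF1 : F ≤ 1 := measureReal_le_one
  have hP : P {ω | x < Z ω} = ENNReal.ofReal (1 - F) := by
    have h := prob_compl_eq_one_sub₀ (μ := P)
      (nullMeasurableSet_le hZ (aemeasurable_const (b := x)))
    have e : {ω | x < Z ω} = {ω | Z ω ≤ x}ᶜ := by ext ω; simp
    rw [e, h, ENNReal.ofReal_sub _ hF0, ENNReal.ofReal_one, hF, ofReal_measureReal]
  -- `{x < q}` lies between `(F, 1)` and `[F, 1)`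
  rw [hP, Measure.restrict_apply' measurableSet_Ioo]
  refine le_antisymm ?_ ?_
  · rw [← Real.volume_Ioo]
    refine measure_mono fun t ht => ?_
    have ht' : t ∈ Set.Ioo (0 : ℝ) 1 := ⟨hF0.trans_lt ht.1, ht.2⟩
    refine ⟨show x < q t from lt_of_not_ge fun hle => ?_, ht'⟩
    exact absurd (hq.le_measureReal_of_le ht' hle) (not_le.2 ht.1)
  · rw [← Real.volume_Ico]
    refine measure_mono fun t ht => ⟨?_, ht.2.2⟩
    exact le_of_not_gt fun hlt => absurd (hq.le_of_lt_measureReal ht.2 hlt) (not_le.2 ht.1)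

end IsQuantileFunction

theorem comonotone_of_monotoneOn {q r : ℝ → ℝ} (hq : MonotoneOn q (Set.Ioo (0 : ℝ) 1))
    (hr : MonotoneOn r (Set.Ioo (0 : ℝ) 1)) :
    Comonotone (volume.restrict (Set.Ioo (0 : ℝ) 1)) q r := by
  intro s t
  by_cases h : ∀ x ∈ Set.Ioo (0 : ℝ) 1, s < q x → t < r x
  · left
    filter_upwards [ae_restrict_mem measurableSet_Ioo] with x hx
    exact h x hx
  · right
    push Not at h
    obtain ⟨x, hx, hsx, htx⟩ := h
    filter_upwards [ae_restrict_mem measurableSet_Ioo] with y hy hty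
    have hxy : x ≤ y := le_of_not_ge fun hyx => absurd (hr hy hx hyx)
      (not_le.2 (lt_of_le_of_lt htx hty))
    exact lt_of_lt_of_le hsx (hq hx hy hxy)

end

section

/-! ### Rearrangements on a nonatomic space -/

theorem measure_iUnion_le_of_chain {ι : Type*} [Countable ι] {B : ι → Set Ω}
    (hB : ∀ i j, B i ≤ᵐ[P] B j ∨ B j ≤ᵐ[P] B i) {t : ℝ≥0∞} (ht : ∀ i, P (B i) ≤ t) :
    P (⋃ i, B i) ≤ t := by
  rcases isEmpty_or_nonempty ι with hι | hι
  · simp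
  obtain ⟨e, he⟩ := exists_surjective_nat ι
  rw [← he.iUnion_comp B, measure_iUnion_eq_iSup_accumulate]
  refine iSup_le fun n => ?_
  obtain ⟨k, hk⟩ : ∃ k, Set.accumulate (fun n => B (e n)) n ≤ᵐ[P] B k := by
    induction n with
    | zero => exact ⟨e 0, by rw [Set.accumulate_zero_nat]; exact EventuallyLE.refl _ _⟩
    | succ n ih =>
      obtain ⟨k, hk⟩ := ih
      rw [Set.accumulate_succ]
      rcases hB k (e (n + 1)) with h | h
      · exact ⟨e (n + 1), by
          simpa using ae_le_set_union (hk.trans h) (EventuallyLE.refl _ (B (e (n + 1))))⟩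
      · exact ⟨k, by simpa using ae_le_set_union hk h⟩
  exact (measure_mono_ae hk).trans (ht k)

/-- Almost sure inclusion of events. -/
def AELe (P : Measure Ω) (A B : {A : Set Ω // MeasurableSet A}) : Prop := A.1 ≤ᵐ[P] B.1

theorem aeLe_or_aeLe {M : Set {A : Set Ω // MeasurableSet A}} (hM : IsChain (AELe P) M)
    {A B : {A : Set Ω // MeasurableSet A}} (hA : A ∈ M) (hB : B ∈ M) :
    A.1 ≤ᵐ[P] B.1 ∨ B.1 ≤ᵐ[P] A.1 := by
  by_cases h : A = B
  · subst h
    exact Or.inl (EventuallyLE.refl _ _)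
  · exact hM hA hB h

theorem mem_of_isMaxChain {M : Set {A : Set Ω // MeasurableSet A}} (hM : IsMaxChain (AELe P) M)
    {A : {A : Set Ω // MeasurableSet A}} (h : ∀ B ∈ M, A.1 ≤ᵐ[P] B.1 ∨ B.1 ≤ᵐ[P] A.1) : A ∈ M := by
  have := hM.2 (hM.1.insert fun B hB _ => h B hB) (Set.subset_insert A M)
  rw [this]
  exact Set.mem_insert A M

theorem iUnion_ae_le {ι : Type*} [Countable ι] {B : ι → Set Ω} {D : Set Ω}
    (h : ∀ i, B i ≤ᵐ[P] D) : (⋃ i, B i) ≤ᵐ[P] D := by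
  filter_upwards [ae_all_iff.2 h] with ω hω hωB
  obtain ⟨i, hi⟩ := Set.mem_iUnion.1 hωB
  exact hω i hi

/-- Countable unions of members of a chain are comparable to the members of the chain. -/
theorem iUnion_ae_comparable {M : Set {A : Set Ω // MeasurableSet A}} (hM : IsChain (AELe P) M)
    {ι : Type*} [Countable ι] {B : ι → {A : Set Ω // MeasurableSet A}} (hB : ∀ i, B i ∈ M)
    {D : {A : Set Ω // MeasurableSet A}} (hD : D ∈ M) :
    (⋃ i, (B i).1) ≤ᵐ[P] D.1 ∨ D.1 ≤ᵐ[P] ⋃ i, (B i).1 := by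
  by_cases h : ∀ i, (B i).1 ≤ᵐ[P] D.1
  · exact Or.inl (iUnion_ae_le h)
  · push Not at h
    obtain ⟨i, hi⟩ := h
    exact Or.inr (((aeLe_or_aeLe hM (hB i) hD).resolve_left hi).trans
      (Set.subset_iUnion (fun i => (B i).1) i).eventuallyLE)

/-- Among the members of a maximal chain of measure at most `t` there is a largest one. -/
theorem exists_greatest_of_isMaxChain {M : Set {A : Set Ω // MeasurableSet A}}
    (hM : IsMaxChain (AELe P) M) (t : ℝ≥0∞) :
    ∃ A ∈ M, P A.1 ≤ t ∧ ∀ D ∈ M, P D.1 ≤ t → P D.1 ≤ P A.1 := by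
  set L : Set ℝ≥0∞ := (fun A => P A.1) '' {A ∈ M | P A.1 ≤ t} with hL
  have hempty : (⟨∅, MeasurableSet.empty⟩ : {A : Set Ω // MeasurableSet A}) ∈ M :=
    mem_of_isMaxChain hM fun B _ => Or.inl (Set.empty_subset B.1).eventuallyLE
  obtain ⟨u, -, hu, huL⟩ := exists_seq_tendsto_sSup (S := L)
    ⟨_, ⟨_, ⟨hempty, by simp⟩, rfl⟩⟩ (OrderTop.bddAbove L)
  choose B hB hBu using huL
  refine ⟨⟨⋃ n, (B n).1, MeasurableSet.iUnion fun n => (B n).2⟩,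
    mem_of_isMaxChain hM fun D hD => iUnion_ae_comparable hM.1 (fun n => (hB n).1) hD,
    measure_iUnion_le_of_chain (fun i j => aeLe_or_aeLe hM.1 (hB i).1 (hB j).1)
      fun n => (hB n).2, fun D hD hDt => ?_⟩
  refine (le_sSup (a := P D.1) (s := L) ⟨D, ⟨hD, hDt⟩, rfl⟩).trans (le_of_tendsto' hu fun n => ?_)
  rw [← hBu n]
  exact measure_mono (Set.subset_iUnion (fun n => (B n).1) n)

theorem isMaxChain_compl {M : Set {A : Set Ω // MeasurableSet A}} (hM : IsMaxChain (AELe P) M) :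
    IsMaxChain (AELe P) {A | (⟨A.1ᶜ, A.2.compl⟩ : {A : Set Ω // MeasurableSet A}) ∈ M} := by
  have hcompl : ∀ {A B : Set Ω}, A ≤ᵐ[P] B → (Bᶜ : Set Ω) ≤ᵐ[P] (Aᶜ : Set Ω) := fun h => by
    filter_upwards [h] with ω hω hB hA
    exact hB (hω hA)
  have hright : ∀ {A B : Set Ω}, A ≤ᵐ[P] (Bᶜ : Set Ω) → B ≤ᵐ[P] (Aᶜ : Set Ω) := fun {A B} h => by
    have := hcompl h
    rwa [compl_compl] at this
  have hleft : ∀ {A B : Set Ω}, (Aᶜ : Set Ω) ≤ᵐ[P] B → (Bᶜ : Set Ω) ≤ᵐ[P] A := fun {A B} h => by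
    have := hcompl h
    rwa [compl_compl] at this
  have hboth : ∀ {A B : Set Ω}, (Aᶜ : Set Ω) ≤ᵐ[P] (Bᶜ : Set Ω) → B ≤ᵐ[P] A := fun {A B} h => by
    have := hright h
    rwa [compl_compl] at this
  constructor
  · intro A hA B hB _
    exact (aeLe_or_aeLe hM.1 hA hB).symm.imp hboth hboth
  · intro N hN hMN
    refine hMN.antisymm fun A hA => mem_of_isMaxChain hM fun B hB => ?_
    have hB' : (⟨B.1ᶜ, B.2.compl⟩ : {A : Set Ω // MeasurableSet A}) ∈ N :=
      hMN (by simpa using hB)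
    exact (aeLe_or_aeLe hN hA hB').symm.imp hleft hright

variable [IsProbabilityMeasure P]

theorem ae_le_of_measure_le {M : Set {A : Set Ω // MeasurableSet A}} (hM : IsChain (AELe P) M)
    {A B : {A : Set Ω // MeasurableSet A}} (hA : A ∈ M) (hB : B ∈ M) (h : P A.1 ≤ P B.1) :
    A.1 ≤ᵐ[P] B.1 := by
  rcases aeLe_or_aeLe hM hA hB with h' | h'
  · exact h'
  · exact (ae_eq_of_ae_subset_of_measure_ge h' h B.2.nullMeasurableSet
      (measure_ne_top P _)).symm.le

/-- Among the members of a maximal chain of measure at least `t` there is a smallest one. -/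
theorem exists_least_of_isMaxChain {M : Set {A : Set Ω // MeasurableSet A}}
    (hM : IsMaxChain (AELe P) M) {t : ℝ≥0∞} (ht : t ≤ 1) :
    ∃ A ∈ M, t ≤ P A.1 ∧ ∀ D ∈ M, t ≤ P D.1 → P A.1 ≤ P D.1 := by
  obtain ⟨A, hA, hAt, hmax⟩ := exists_greatest_of_isMaxChain (isMaxChain_compl hM) (1 - t)
  have hA1 : P A.1 ≤ 1 := prob_le_one
  refine ⟨⟨A.1ᶜ, A.2.compl⟩, hA, ?_, fun D hD hDt => ?_⟩
  · rw [prob_compl_eq_one_sub A.2]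
    exact (ENNReal.le_sub_iff_add_le_right (measure_ne_top P _) hA1).2
      ((add_le_add_right hAt t).trans_eq (add_tsub_cancel_of_le ht))
  · have h := hmax ⟨D.1ᶜ, D.2.compl⟩ (by simpa using hD)
      (by rw [prob_compl_eq_one_sub D.2]; exact tsub_le_tsub_left hDt 1)
    rw [prob_compl_eq_one_sub A.2]
    have e : P D.1 = 1 - P D.1ᶜ := by
      simpa using prob_compl_eq_one_sub (μ := P) D.2.compl
    rw [e]
    exact tsub_le_tsub_left h 1

/-- On a nonatomic space, a maximal chain of events takes all values in `[0, 1]`: if it skipped `t`,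
an event could be inserted between its largest member of measure at most `t` and its smallest one
of measure at least `t`. -/
theorem exists_measure_eq_of_isMaxChain (hP : IsNonatomic P)
    {M : Set {A : Set Ω // MeasurableSet A}} (hM : IsMaxChain (AELe P) M) {t : ℝ≥0∞} (ht : t ≤ 1) :
    ∃ A ∈ M, P A.1 = t := by
  obtain ⟨A, hA, hAt, hmax⟩ := exists_greatest_of_isMaxChain hM t
  obtain ⟨B, hB, hBt, hmin⟩ := exists_least_of_isMaxChain hM ht
  have hAB : A.1 ≤ᵐ[P] B.1 := ae_le_of_measure_le hM.1 hA hB (hAt.trans hBt)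
  by_contra! hne
  have hlt : P A.1 < P B.1 := (lt_of_le_of_ne hAt (hne A hA)).trans_le hBt
  have hsum : P A.1 + P (B.1 \ A.1) = P B.1 := by
    rw [← measure_union Set.disjoint_sdiff_right (B.2.diff A.2)]
    refine measure_congr ?_
    filter_upwards [hAB] with ω hω
    refine propext ⟨fun h => h.elim (fun h => hω h) fun h => h.1, fun h => ?_⟩
    by_cases hA : ω ∈ A.1
    · exact Or.inl hA
    · exact Or.inr ⟨h, hA⟩
  have hpos : 0 < P (B.1 \ A.1) := by
    refine pos_iff_ne_zero.2 fun h0 => ?_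
    rw [h0, add_zero] at hsum
    exact hlt.ne hsum
  obtain ⟨S, hS, hSm, hS0, hSlt⟩ := hP _ (B.2.diff A.2) hpos
  have hN : P (A.1 ∪ S) = P A.1 + P S :=
    measure_union (Set.disjoint_sdiff_right.mono_right hS) hSm
  have hmem : (⟨A.1 ∪ S, A.2.union hSm⟩ : {A : Set Ω // MeasurableSet A}) ∈ M := by
    refine mem_of_isMaxChain hM fun D hD => ?_
    rcases le_total (P D.1) t with h | h
    · exact Or.inr ((ae_le_of_measure_le hM.1 hD hA (hmax D hD h)).trans
        Set.subset_union_left.eventuallyLE)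
    · left
      refine EventuallyLE.trans ?_ (ae_le_of_measure_le hM.1 hB hD (hmin D hD h))
      filter_upwards [hAB] with ω hω hωN
      exact hωN.elim (fun h => hω h) fun h => (hS h).1
  rcases le_total (P (A.1 ∪ S)) t with h | h
  · have := hmax _ hmem h
    rw [hN] at this
    exact absurd this (not_le.2 (ENNReal.lt_add_right (measure_ne_top P _) hS0.ne'))
  · have := hmin _ hmem h
    rw [hN, ← hsum] at this
    exact absurd this (not_le.2 (ENNReal.add_lt_add_left (measure_ne_top P _) hSlt))

/-- On a nonatomic space, every bounded `f` has a rearrangement comonotone with a given `g`. A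
maximal chain through the level sets of `g` contains events `B r` with `P (B r) = P (f > r)`, for
rational `r`, and the rearrangement is the supremum of the `r` with `ω ∈ B r`. -/
theorem exists_identDistrib_comonotone (hP : IsNonatomic P) {f g : Ω → ℝ} (hf : AEMeasurable f P)
    (hg : Measurable g) {C : ℝ} (hC : ∀ᵐ ω ∂P, |f ω| ≤ C) :
    ∃ f' : Ω → ℝ, Measurable f' ∧ IdentDistrib f' f P P ∧ Comonotone P f' g := by
  -- the strict upper level sets of `g`
  set 𝒞 : Set {A : Set Ω // MeasurableSet A} :=
    Set.range fun s : ℝ => ⟨{ω | s < g ω}, measurableSet_lt measurable_const hg⟩ with h𝒞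
  have hchain : IsChain (AELe P) 𝒞 := by
    rintro _ ⟨s, rfl⟩ _ ⟨t, rfl⟩ _
    rcases le_total s t with h | h
    · exact Or.inr (LE.le.eventuallyLE fun ω (hω : t < g ω) => lt_of_le_of_lt h hω)
    · exact Or.inl (LE.le.eventuallyLE fun ω (hω : s < g ω) => lt_of_le_of_lt h hω)
  obtain ⟨M, hM, hCM⟩ := hchain.exists_maxChain
  have hgM : ∀ s, (⟨{ω | s < g ω}, measurableSet_lt measurable_const hg⟩ :
      {A : Set Ω // MeasurableSet A}) ∈ M := fun s => hCM ⟨s, rfl⟩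
  have hB : ∀ r : ℚ, ∃ B ∈ M, P B.1 = P {ω | (r : ℝ) < f ω} := fun r =>
    exists_measure_eq_of_isMaxChain hP hM prob_le_one
  choose B hBM hBP using hB
  classical
  -- values are truncated to `[-C, C]`, to keep the supremum finite
  let h : ℚ → Ω → ℝ := fun r ω => if ω ∈ (B r).1 then max (-C) (min r C) else -C
  have hC0 : -C ≤ C := by
    obtain ⟨ω, hω⟩ := hC.exists
    linarith [abs_nonneg (f ω)]
  have hhC : ∀ r ω, h r ω ≤ C := by
    intro r ω
    simp only [h]
    split_ifs
    · exact max_le hC0 (min_le_right _ _)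
    · exact hC0
  have hhC' : ∀ r ω, -C ≤ h r ω := by
    intro r ω
    simp only [h]
    split_ifs
    · exact le_max_left _ _
    · exact le_rfl
  have hbdd : ∀ ω, BddAbove (Set.range fun r => h r ω) := fun ω => ⟨C, by
    rintro _ ⟨r, rfl⟩
    exact hhC r ω⟩
  have hlt_iff : ∀ (r : ℚ) (t : ℝ) (ω : Ω), -C ≤ t → t < C →
      (t < h r ω ↔ t < r ∧ ω ∈ (B r).1) := by
    intro r t ω h1 h2
    simp only [h]
    split_ifs with hω
    · simp [hω, not_lt.2 h1, h2]
    · simp [hω, h1]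
  have hlow : ∀ t < -C, {ω | t < ⨆ r, h r ω} = Set.univ := fun t ht =>
    Set.eq_univ_of_forall fun ω => ht.trans_le ((hhC' 0 ω).trans (le_ciSup (hbdd ω) 0))
  have hhigh : ∀ t, C ≤ t → {ω | t < ⨆ r, h r ω} = ∅ := fun t ht =>
    Set.eq_empty_of_forall_notMem fun ω hω =>
      absurd ((ciSup_le fun r => hhC r ω).trans ht) (not_le.2 hω)
  have hmid : ∀ t, -C ≤ t → t < C →
      {ω | t < ⨆ r, h r ω} = ⋃ r : {r : ℚ // t < r}, (B r).1 := by
    intro t h1 h2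
    ext ω
    simp only [Set.mem_ofPred_eq, lt_ciSup_iff (hbdd ω), hlt_iff _ t ω h1 h2, Set.mem_iUnion,
      Subtype.exists, exists_prop]
  refine ⟨fun ω => ⨆ r, h r ω, ?_, ?_, ?_⟩
  · exact Measurable.iSup fun r => Measurable.ite (B r).2 measurable_const measurable_const
  · have hm : Measurable fun ω => ⨆ r, h r ω :=
      Measurable.iSup fun r => Measurable.ite (B r).2 measurable_const measurable_const
    refine identDistrib_of_measure_lt_eq hm.aemeasurable hf fun t => ?_
    rcases lt_or_ge t (-C) with h1 | h1
    · rw [hlow t h1]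
      refine (measure_congr ?_).symm
      filter_upwards [hC] with ω hω
      exact propext ⟨fun _ => trivial, fun _ => h1.trans_le (abs_le.1 hω).1⟩
    rcases le_or_gt C t with h2 | h2
    · rw [hhigh t h2]
      refine (measure_congr ?_).symm
      filter_upwards [hC] with ω hω
      exact propext ⟨fun h => absurd (lt_of_le_of_lt h2 h) (not_lt.2 (abs_le.1 hω).2),
        fun h => h.elim⟩
    rw [hmid t h1 h2]
    have hf_eq : {ω | t < f ω} = ⋃ r : {r : ℚ // t < r}, {ω | ((r : ℚ) : ℝ) < f ω} := by
      ext ω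
      simp only [Set.mem_ofPred_eq, Set.mem_iUnion, Subtype.exists, exists_prop]
      exact ⟨fun h => exists_rat_btwn h, fun ⟨r, h1, h2⟩ => h1.trans h2⟩
    refine le_antisymm ?_ ?_
    · refine measure_iUnion_le_of_chain (fun i j => aeLe_or_aeLe hM.1 (hBM i.1) (hBM j.1))
        fun r => ?_
      rw [hBP]
      exact measure_mono fun ω hω => r.2.trans hω
    · rw [hf_eq]
      refine measure_iUnion_le_of_chain (fun i j => ?_) fun r => ?_
      · rcases le_total (i.1 : ℝ) j.1 with hij | hij
        · exact Or.inr (LE.le.eventuallyLE fun ω hω => lt_of_le_of_lt hij hω)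
        · exact Or.inl (LE.le.eventuallyLE fun ω hω => lt_of_le_of_lt hij hω)
      · rw [← hBP]
        exact measure_mono (Set.subset_iUnion (fun r : {r : ℚ // t < r} => (B r).1) r)
  · intro t s
    rcases lt_or_ge t (-C) with h1 | h1
    · rw [hlow t h1]
      exact Or.inr (Set.subset_univ _).eventuallyLE
    rcases le_or_gt C t with h2 | h2
    · rw [hhigh t h2]
      exact Or.inl (Set.empty_subset _).eventuallyLE
    rw [hmid t h1 h2]
    exact iUnion_ae_comparable hM.1 (fun r : {r : ℚ // t < r} => hBM r) (hgM s)

/-! ### Law-invariant return risk measures -/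

theorem integral_eq_integral_mul_density (Q : AbsContProb P) (f : Ω → ℝ) :
    ∫ ω, f ω ∂(Q.1 : Measure Ω) = ∫ ω, f ω * density Q ω ∂P := by
  rw [← integral_rnDeriv_smul Q.2]
  exact integral_congr_ae (Eventually.of_forall fun ω => mul_comm _ _)

variable {ρ : LInfPP P → ℝ} {Q : AbsContProb P} {X : LInfPP P} {q r : ℝ → ℝ}

/-- The Hardy–Littlewood inequality for `log X` and `dQ/dP`. -/
theorem expMeanLog_le_expQuantileIntegral
    (hq : IsQuantileFunction P (fun ω => Real.log (X ω)) q)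
    (hr : IsQuantileFunction P (density Q) r) : expMeanLog Q X ≤ expQuantileIntegral q r := by
  refine ENNReal.ofReal_le_ofReal (Real.exp_le_exp.2 ?_)
  rw [integral_eq_integral_mul_density]
  have hb : ∀ᵐ ω ∂P, |Real.log (X ω)| ≤ ‖logRV X‖ := by
    filter_upwards [ae_abs_le_norm (logRV X), coeFn_logRV X] with ω h1 h2
    rwa [← h2]
  exact integral_mul_le_of_comonotone
    (hq.identDistrib (memLp_log X).aestronglyMeasurable.aemeasurable)
    (hr.identDistrib (measurable_density Q).aemeasurable) hb
    (Eventually.of_forall fun ω => ENNReal.toReal_nonneg) (integrable_density Q)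
    (comonotone_of_monotoneOn hq.monotoneOn hr.monotoneOn)

/-- The quantile integral is the exponential mean of a rearrangement of `X` that is comonotone with
the density. -/
theorem exists_identDistrib_expMeanLog_eq (hP : IsNonatomic P)
    (hq : IsQuantileFunction P (fun ω => Real.log (X ω)) q)
    (hr : IsQuantileFunction P (density Q) r) :
    ∃ Y : LInfPP P, IdentDistrib Y X P P ∧ expMeanLog Q Y = expQuantileIntegral q r := by
  have hlog : AEMeasurable (fun ω => Real.log (X ω)) P :=
    (memLp_log X).aestronglyMeasurable.aemeasurable
  have hb : ∀ᵐ ω ∂P, |Real.log (X ω)| ≤ ‖logRV X‖ := by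
    filter_upwards [ae_abs_le_norm (logRV X), coeFn_logRV X] with ω h1 h2
    rwa [← h2]
  obtain ⟨f, hfm, hfX, hfd⟩ := exists_identDistrib_comonotone hP hlog (measurable_density Q) hb
  have hfb : ∀ᵐ ω ∂P, |f ω| ≤ ‖logRV X‖ :=
    hfX.symm.ae_snd (measurableSet_le continuous_abs.measurable measurable_const) hb
  have hfL : MemLp f ∞ P := memLp_top_of_bound hfm.aestronglyMeasurable _ hfb
  have hY : expRV (hfL.toLp f) =ᵐ[P] fun ω => Real.exp (f ω) := by
    filter_upwards [coeFn_expRV (hfL.toLp f), hfL.coeFn_toLp] with ω h1 h2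
    rw [h1, h2]
  have hX : (fun ω => Real.exp (Real.log (X ω))) =ᵐ[P] X := by
    filter_upwards [X.ae_pos] with ω hω
    exact Real.exp_log hω
  refine ⟨expRV (hfL.toLp f), ?_, ?_⟩
  · exact (IdentDistrib.of_ae_eq (expRV (hfL.toLp f)).aestronglyMeasurable.aemeasurable hY).trans
      ((hfX.comp Real.measurable_exp).trans
        (IdentDistrib.of_ae_eq (Real.measurable_exp.comp_aemeasurable hlog) hX))
  · have hfq := hfX.trans (hq.identDistrib hlog)
    have hdr := hr.identDistrib (measurable_density Q).aemeasurable
    have hd0 : 0 ≤ᵐ[P] density Q := Eventually.of_forall fun ω => ENNReal.toReal_nonneg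
    have h1 := integral_mul_le_of_comonotone hfq hdr hfb hd0 (integrable_density Q)
      (comonotone_of_monotoneOn hq.monotoneOn hr.monotoneOn)
    have h2 := integral_mul_le_of_comonotone hfq.symm hdr.symm
      (hfq.ae_snd (measurableSet_le continuous_abs.measurable measurable_const) hfb)
      (hdr.ae_snd measurableSet_Ici hd0) (hdr.integrable_snd (integrable_density Q)) hfd
    rw [expMeanLog_eq, logRV_expRV, expectation_apply,
      integral_congr_ae (Q.2.ae_le hfL.coeFn_toLp), integral_eq_integral_mul_density,
      le_antisymm h1 h2]
    rfl

theorem alpha_eq_quantile (hP : IsNonatomic P) (hlaw : LawInvariant ρ) {qlog : LInfPP P → ℝ → ℝ}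
    (hq : ∀ X, IsQuantileFunction P (fun ω => Real.log (X ω)) (qlog X))
    (hr : IsQuantileFunction P (density Q) r) :
    alpha ρ Q = (⨆ X ∈ acceptanceSet ρ, expQuantileIntegral (qlog X) r)⁻¹ := by
  rw [alpha]
  congr 1
  refine le_antisymm (iSup₂_mono fun X _ => expMeanLog_le_expQuantileIntegral (hq X) hr)
    (iSup₂_le fun X hX => ?_)
  obtain ⟨Y, hYX, hY⟩ := exists_identDistrib_expMeanLog_eq hP (hq X) hr
  have hYB : Y ∈ acceptanceSet ρ := (hlaw Y X hYX).trans_le hX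
  rw [← hY]
  exact le_iSup₂ (f := fun X (_ : X ∈ acceptanceSet ρ) => expMeanLog Q X) Y hYB

theorem ofReal_eq_iSup_quantile (hP : IsNonatomic P) (hρ : IsReturnRiskMeasure ρ)
    (hconv : IsGGConvex ρ) (hfatou : LowerBoundedFatou ρ) (hlaw : LawInvariant ρ)
    {qden : AbsContProb P → ℝ → ℝ}
    (hq : IsQuantileFunction P (fun ω => Real.log (X ω)) q)
    (hr : ∀ Q, IsQuantileFunction P (density Q) (qden Q)) :
    ENNReal.ofReal (ρ X) =
      ⨆ Q : AbsContProb P, alpha ρ Q * expQuantileIntegral q (qden Q) := by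
  refine le_antisymm ?_ (iSup_le fun Q => ?_)
  · rw [ofReal_eq_iSup_alpha_mul hρ hconv hfatou X]
    exact iSup_mono fun Q => mul_le_mul_right (expMeanLog_le_expQuantileIntegral hq (hr Q)) _
  · obtain ⟨Y, hYX, hY⟩ := exists_identDistrib_expMeanLog_eq hP hq (hr Q)
    rw [← hY, ← hlaw Y X hYX]
    exact alpha_mul_expMeanLog_le hρ Q Y

end

end ReturnRisk

theorem mainTheorem5 {Ω : Type*} [MeasurableSpace Ω] (P : MeasureTheory.Measure Ω)
    [MeasureTheory.IsProbabilityMeasure P] (hP : ReturnRisk.IsNonatomic P)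
    (ρ : ReturnRisk.LInfPP P → ℝ) (hρ : ReturnRisk.IsReturnRiskMeasure ρ)
    (hconv : ReturnRisk.IsGGConvex ρ) (hfatou : ReturnRisk.LowerBoundedFatou ρ) :
    (∀ Q : ReturnRisk.AbsContProb P, ReturnRisk.alpha ρ Q ≤ 1) ∧
    (∀ X : ReturnRisk.LInfPP P, ENNReal.ofReal (ρ X) =
      ⨆ Q : ReturnRisk.AbsContProb P, ReturnRisk.alpha ρ Q * ReturnRisk.expMeanLog Q X) ∧
    (ReturnRisk.LowerBoundedLebesgue ρ → ∀ X : ReturnRisk.LInfPP P,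
      ∃ Q : ReturnRisk.AbsContProb P,
        ENNReal.ofReal (ρ X) = ReturnRisk.alpha ρ Q * ReturnRisk.expMeanLog Q X) ∧
    (ReturnRisk.LawInvariant ρ →
      ∀ (qlog : ReturnRisk.LInfPP P → ℝ → ℝ) (qden : ReturnRisk.AbsContProb P → ℝ → ℝ),
        (∀ X, ReturnRisk.IsQuantileFunction P (fun ω => Real.log (X ω)) (qlog X)) →
        (∀ Q, ReturnRisk.IsQuantileFunction P (ReturnRisk.density Q) (qden Q)) →
        (∀ Q : ReturnRisk.AbsContProb P, ReturnRisk.alpha ρ Q =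
          (⨆ X ∈ ReturnRisk.acceptanceSet ρ,
            ReturnRisk.expQuantileIntegral (qlog X) (qden Q))⁻¹) ∧
        (∀ X : ReturnRisk.LInfPP P, ENNReal.ofReal (ρ X) =
          ⨆ Q : ReturnRisk.AbsContProb P,
            ReturnRisk.alpha ρ Q * ReturnRisk.expQuantileIntegral (qlog X) (qden Q))) := by
  open ReturnRisk in
  exact ⟨alpha_le_one hρ, ofReal_eq_iSup_alpha_mul hρ hconv hfatou,
    exists_ofReal_eq_alpha_mul hρ hconv, fun hlaw qlog qden hq hr =>
      ⟨fun Q => alpha_eq_quantile hP hlaw hq (hr Q),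
        fun X => ofReal_eq_iSup_quantile hP hρ hconv hfatou hlaw (hq X) hr⟩⟩
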